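/- **Setting.** Identify $\mathbb R^2$ with $\mathbb C$, so that $p=(p_1,p_2)$ is the number $p_1+ip_2$. Let $\Omega\subset\mathbb R^2$ be a bounded domain (nonempty, open, connected) whose boundary has, near every point, a regular $C^5$ parametrization. Let $a$ be a positive function in $C^5(\overline\Omega)$ (i.e. $a$ is $C^5$ on an open set containing $\overline\Omega$ and positive on $\overline\Omega$), $\tilde a=-\ln a$. For $h>0$ put $$\Omega_h=\Omega\cap h\mathbb Z^2,\qquad \Omega_h^\circ=\{s\in\Omega_h: s+[-h,h]^2\subseteq\Omega\},\qquad \partial\Omega_h=\Omega_h\setminus\Omega_h^\circ,\qquad \mathcal S=[-1,1]^2\cap\mathbb Z^2 .$$ **Taylor coefficients.** Let $\partial_{\mathbb C}^{(k,l)}=2^{-k-l}(\partial_x-i\partial_y)^k(\partial_x+i\partial_y)^l$ and $N^{k,l}(p)=p^k\bar p^{\,l}/(k!\,l!)$. At a base point $b$ put, for $k,l\ge1$, $\tilde a^{k,l}_{m,n}=\big(\tfrac m{2k}+\tfrac n{2l}-\tfrac{mn}{kl}\big)\binom km\binom ln\,\partial_{\mathbb C}^{(k-m,l-n)}\tilde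 a(b)$. Let $\tilde A^{k,l}_{m,n}=\delta_{km}\delta_{ln}$ if $kl=0$, and otherwise $\tilde A^{k,l}_{m,n}=\sum\tilde a^{k,l}_{i,j}\tilde A^{i,j}_{m,n}$, summed over $m\le i\le k$, $n\le j\le l$, $(i,j)\ne(k,l)$. Let $A^k_{m,0}(p)=\sum_{j=m}^kN^{j,k-j}(p)\tilde A^{j,k-j}_{m,0}$. **Sign normalization.** For a finite $S\subset\mathbb Z^2$ and reals $c_{p,j}$ ($p\in S$, $0\le j\le J$), and given numbers $\lambda_1,\dots,\lambda_J$, put $q_0=1$, $q_j=\sum_{k=1}^j\lambda_kq_{j-k}$, $\tilde c_{p,j}=\sum_{k=0}^jq_{j-k}c_{p,k}$ and $C_p(h)=\sum_{j=0}^J\tilde c_{p,j}h^j$. **Interior stencils.** For $s\in\Omega_h^\circ$ let $\mathcal S_s=\mathcal S$ and $J=7$. With base point $b=s$, let $c_{p,j}\in\mathbb R$ be any solution with $c_{(0,0),0}>0$ of $$\sum_{p\in\mathcal S}\operatorname{Re}(A^m_{m,0}(p))\,c_{p,j}=-\sum_{k=0}^{j-1}\sum_{p\in\mathcal S}\operatorname{Re}(A^{m+j-k}_{m,0}(p))\,c_{p,k}\quad(0\le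 j\le7,\ 0\le m\le7-j)$$ and of the same equations with $\operatorname{Im}$ in place of $\operatorname{Re}$ for $0\le j\le 7$, $1\le m\le7-j$. The coefficients $C_p(h)$ are obtained by the sign normalization with $\lambda_j=\max\{\max_{p\in\mathcal S}(-c_{p,j}/c_{p,0}),0\}$. **Boundary stencils.** For $s\in\partial\Omega_h$ choose $b\in\partial\Omega\cap(s+[-h,h]^2)$; if this set contains points $b$ for which $b-s$ is horizontal, vertical or at $\pm45^\circ$, take a closest one among those. Let $\gamma$ be a regular $C^5$ parametrization of $\partial\Omega$ near $b=\gamma(t)$, $\theta=\operatorname{Arg}\gamma'(t)$, $L$ the line through $b$ with direction $e^{i\theta}$, and $H$ the open half plane to its left, $\gamma$ being directed so that $s\in H$. Let $g$ be a symmetry of the square $[-1,1]^2$ such that $\{p\in\mathcal S: s+h\,g(p)\notin\Omega\cap H\}$ is one of the following sets: - I: $\{(-1,-1),(0,-1),(1,-1),(1,0)\}$; - II: $\{(-1,-1),(0,-1),(1,-1)\}$; - III: $\{(0,-1),(1,-1),(1,0)\}$; - IV: $\{(0,-1),(1,-1)\}$; - V: $\{(1,-1)\}$; - VI: $\{(-1,-1),(0,-1),(1,-1),(-1,0),(1,0)\}$;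 - VII: $\{(-1,-1),(0,-1),(1,-1),(1,0),(1,1)\}$; - VIII: $\{(-1,-1),(1,-1)\}$. The stencil is $\mathcal S_s=g(T)$, with $T$ given by - I: $T_1=\{(0,0),(-1,0),(-1,1),(-1,2),(0,2),(1,2),(1,1)\}$; - II, IV, VIII: $T_2=T_1\cup\{(1,0)\}$; - III: $T_3=\{(0,0),(-1,-1),(-1,0),(-1,1),(-2,1),(-1,2),(0,1),(1,1)\}$; - V: $T_4=\mathcal S\setminus\{(1,-1)\}$; - VI: $T_5=T_1\setminus\{(-1,0)\}$; - VII: $T_6=\{(0,0),(-1,0),(-2,1),(-1,1),(-1,2),(0,1)\}$. Let $C$ be the point of $L$ on the ray from $s$ in the direction $g(0,-1)$ (for $T_1,T_2,T_5$) or $g(1,-1)$ (for $T_3,T_4,T_6$), $r=|C-s|/h$, and $\tau=\tan(\theta_0-\frac\pi4)$, where $g(e^{i\theta_0})=e^{i\theta}$. Put $z_j=\gamma^{(j+1)}(t)/(j+1)!$, $N^{0,0}_j=\delta_{j0}$, $N^{k,l}_j=\frac1k\sum_{n=0}^jN^{k-1,l}_nz_{j-n}$ for $k\ge1$, $N^{l,k}_j=\overline{N^{k,l}_j}$,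 and, with the quantities $\tilde A$, $A^k_{m,0}$ taken at $b$, $$\tilde B_{m,n}=\sum_{j=n}^m\sum_{l=0}^{m-j}N^{j,m-l-j}_l\tilde A^{j,m-l-j}_{n,0}e^{-in\theta},\qquad B_{m,n}=\frac{m!}{|z_0|^m}\Big[\operatorname{Im}\tilde B_{m,n}-\sum_{l=n+1}^{m-1}\operatorname{Re}(\tilde B_{m,l})B_{l,n}\Big],$$ $$A^k_m(p)=-2\operatorname{Im}(A^k_{m,0}(p)e^{-im\theta})+\sum_{n=m+1}^k2\operatorname{Re}(A^k_{n,0}(p)e^{-in\theta})B_{n,m}.$$ With $J=4$ let $c_{p,j}\in\mathbb R$ be any solution with $c_{(0,0),0}=1$ of $$-\sum_{p\in\mathcal S_s}A^m_m\big(p+\tfrac{s-b}h\big)c_{p,j}=\sum_{k=0}^{j-1}\sum_{p\in\mathcal S_s}A^{m+j-k}_m\big(p+\tfrac{s-b}h\big)c_{p,k}\quad(0\le j\le4,\ 1\le m\le5-j)$$ and of the extra equations, where $c(p)$ stands for $c_{g(p),0}$: - for $T_1$: $c(-1,0)-c(1,1)=-\frac r4$; - for $T_2$: $c(-1,0)-c(1,1)=c(1,0)-c(-1,1)=-\frac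 r5$; - for $T_3$: $c(-1,-1)-c(-1,1)=c(1,1)-c(-1,1)=-\frac{(1+|\tau|)r}{15\sqrt2}$; - for $T_4$: $c(0,-1)=c(1,1)$ and $c(1,0)=c(-1,-1)$; - for $T_5,T_6$: none. The coefficients $C_p(h)$ are obtained by the sign normalization with $\lambda_j=\max\big\{\max_{p\in\mathcal S_s}(-c_{p,j}/c_{p,0}),\,0,\,-\sum_{p\in\mathcal S_s}c_{p,j}\big/\sum_{p\in\mathcal S_s}c_{p,0}\big\}$. For a grid function $v_h:\Omega_h\to\mathbb R$ and $s\in\Omega_h$ put $$\mathcal L_hv_h(s)=h^{-\sigma}\sum_{p\in\mathcal S_s}C_p(h)\,v_h(s+ph),\qquad\sigma=2\text{ if }s\in\Omega_h^\circ,\quad\sigma=0\text{ if }s\in\partial\Omega_h .$$ **Theorem (discrete maximum principle).** There is $h_0>0$, depending only on $\Omega$, such that for every $a$ as above, every $0<h<h_0$ and all choices allowed in the construction: $s+ph\in\Omega_h$ for all $s\in\Omega_h$, $p\in\mathcal S_s$ (so that $\mathcal L_h$ acts on grid functions on $\Omega_h$), and if $v_h:\Omega_h\to\mathbb R$ satisfies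 $\mathcal L_hv_h\ge0$ on $\Omega_h$, then $v_h$ attains its minimum over $\Omega_h$ at a point of $\partial\Omega_h$, and this minimum is nonnegative. -/

import Mathlib

open Filter Topology

noncomputable section

namespace CompactFDM

/-! The plane `ℝ²` is identified with `ℂ`. Stencil offsets are elements of `ℤ × ℤ`. -/

/-- The offset `p = (p₁, p₂)` as the complex number `p₁ + i p₂`. -/
def toC (p : ℤ × ℤ) : ℂ := (p.1 : ℂ) + (p.2 : ℂ) * Complex.I

/-! ### Grids -/

/-- `Ω_h = Ω ∩ hℤ²`. -/
def gridPts (Ω : Set ℂ) (h : ℝ) : Set ℂ :=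
  {s | s ∈ Ω ∧ ∃ p : ℤ × ℤ, s = (h : ℂ) * toC p}

/-- The closed square `s + [-h, h]²`. -/
def square (s : ℂ) (h : ℝ) : Set ℂ := {q | |(q - s).re| ≤ h ∧ |(q - s).im| ≤ h}

/-- `Ω_h° = {s ∈ Ω_h : s + [-h, h]² ⊆ Ω}`. -/
def interiorPts (Ω : Set ℂ) (h : ℝ) : Set ℂ := {s | s ∈ gridPts Ω h ∧ square s h ⊆ Ω}

/-- `∂Ω_h = Ω_h \ Ω_h°`. -/
def boundaryPts (Ω : Set ℂ) (h : ℝ) : Set ℂ := gridPts Ω h \ interiorPts Ω h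

/-- The reference stencil `[-1, 1]² ∩ ℤ²`. -/
def refStencil : Finset (ℤ × ℤ) := Finset.Icc (-1) 1 ×ˢ Finset.Icc (-1) 1

/-! ### Complex partial derivatives and the coefficients of the reduced Taylor expansion -/

/-- `½ (∂/∂x - i ∂/∂y)`. -/
def dz (f : ℂ → ℂ) (z : ℂ) : ℂ :=
  (fderiv ℝ f z 1 - Complex.I * fderiv ℝ f z Complex.I) / 2

/-- `½ (∂/∂x + i ∂/∂y)`. -/
def dzbar (f : ℂ → ℂ) (z : ℂ) : ℂ :=
  (fderiv ℝ f z 1 + Complex.I * fderiv ℝ f z Complex.I) / 2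

/-- `ã = - ln a`, as a complex-valued function. -/
def logCoeff (a : ℂ → ℝ) (z : ℂ) : ℂ := ((-Real.log (a z) : ℝ) : ℂ)

/-- The complex partial derivatives `∂_ℂ^{(k,l)} ã` at the point `z`. -/
def jet (a : ℂ → ℝ) (z : ℂ) (k l : ℕ) : ℂ := (dz^[k] (dzbar^[l] (logCoeff a))) z

/-- `ã^{k,l}_{m,n}`, where `D k l` stands for `∂_ℂ^{(k,l)} ã` at the base point. -/
def aTilde (D : ℕ → ℕ → ℂ) (k l m n : ℕ) : ℂ :=
  ((m : ℂ) / (2 * k) + (n : ℂ) / (2 * l) - ((m : ℂ) * n) / (k * l)) *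
    (k.choose m : ℂ) * (l.choose n : ℂ) * D (k - m) (l - n)

/-- The index set `{(i, j) : m ≤ i ≤ k, n ≤ j ≤ l, (i, j) ≠ (k, l)}`. -/
def rect (k l m n : ℕ) : Finset (ℕ × ℕ) :=
  (Finset.Icc m k ×ˢ Finset.Icc n l).erase (k, l)

/-- `Ã^{k,l}_{m,n}`: it is `δ(k - m) δ(l - n)` if `k l = 0`, and otherwise the sum of
`ã^{k,l}_{i,j} Ã^{i,j}_{m,n}` over `(i, j) ∈ rect k l m n`. -/
def bigATilde (D : ℕ → ℕ → ℂ) (m n : ℕ) (k l : ℕ) : ℂ :=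
  if k = 0 ∨ l = 0 then (if k = m ∧ l = n then 1 else 0)
  else ∑ x : rect k l m n, aTilde D k l x.1.1 x.1.2 * bigATilde D m n x.1.1 x.1.2
termination_by k + l
decreasing_by
  have hx := x.2
  simp only [rect, Finset.mem_erase, Finset.mem_product, Finset.mem_Icc, ne_eq,
    Prod.ext_iff, not_and_or] at hx
  omega

/-- `N^{k,l}(p) = p^k (conj p)^l / (k! l!)`. -/
def taylorN (k l : ℕ) (p : ℂ) : ℂ :=
  p ^ k * (starRingEnd ℂ p) ^ l / ((k.factorial : ℂ) * (l.factorial : ℂ))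

/-- `A^k_{m,0}(p) = ∑_{j=m}^{k} N^{j,k-j}(p) Ã^{j,k-j}_{m,0}`. -/
def coefA (D : ℕ → ℕ → ℂ) (k m : ℕ) (p : ℂ) : ℂ :=
  ∑ j ∈ Finset.Icc m k, taylorN j (k - j) p * bigATilde D m 0 j (k - j)

/-! ### Normalization of the signs of the coefficients

Raw coefficients `c p j` (`p` an offset, `j` the power of `h`) are turned into
`c̃_{p,j} = ∑_{k=0}^{j} q_{j-k} c_{p,k}` with `q_0 = 1`, `q_j = ∑_{k=1}^{j} λ_k q_{j-k}`. -/

/-- `q_j`, defined from `λ_1, λ_2, …`. -/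
def qSeq (lam : ℕ → ℝ) : ℕ → ℝ
  | 0 => 1
  | j + 1 => ∑ k : Fin (j + 1), lam (k + 1) * qSeq lam (j - k)
termination_by j => j
decreasing_by omega

/-- `λ_j = max {max_{p ∈ S} (-c_{p,j} / c_{p,0}), 0}`. -/
def lamInterior (S : Finset (ℤ × ℤ)) (c : ℤ × ℤ → ℕ → ℝ) (j : ℕ) : ℝ :=
  S.fold max 0 (fun p => -(c p j / c p 0))

/-- `λ̃_j = max {λ_j, -(∑_{p ∈ S} c_{p,j}) / (∑_{p ∈ S} c_{p,0})}`. -/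
def lamBoundary (S : Finset (ℤ × ℤ)) (c : ℤ × ℤ → ℕ → ℝ) (j : ℕ) : ℝ :=
  max (lamInterior S c j) (-((∑ p ∈ S, c p j) / (∑ p ∈ S, c p 0)))

/-- `C̃_p(h) = ∑_{j=0}^{J} c̃_{p,j} h^j` with `c̃_{p,j} = ∑_{k=0}^{j} q_{j-k} c_{p,k}`. -/
def modified (lam : ℕ → ℝ) (c : ℤ × ℤ → ℕ → ℝ) (J : ℕ) (h : ℝ) (p : ℤ × ℤ) : ℝ :=
  ∑ j ∈ Finset.range (J + 1),
    (∑ k ∈ Finset.range (j + 1), qSeq lam (j - k) * c p k) * h ^ j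

/-! ### Interior stencils (`M = 6`) -/

/-- The linear equations for the interior coefficients `c_{p,j}`, `p ∈ [-1,1]² ∩ ℤ²`,
`0 ≤ j ≤ 7`. -/
def InteriorSystem (D : ℕ → ℕ → ℂ) (c : ℤ × ℤ → ℕ → ℝ) : Prop :=
  (∀ j m : ℕ, j ≤ 7 → m ≤ 7 - j →
    ∑ p ∈ refStencil, (coefA D m m (toC p)).re * c p j =
      -∑ k ∈ Finset.range j, ∑ p ∈ refStencil, (coefA D (m + j - k) m (toC p)).re * c p k) ∧
  (∀ j m : ℕ, j ≤ 7 → 1 ≤ m → m ≤ 7 - j →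
    ∑ p ∈ refStencil, (coefA D m m (toC p)).im * c p j =
      -∑ k ∈ Finset.range j, ∑ p ∈ refStencil, (coefA D (m + j - k) m (toC p)).im * c p k)

/-- `C` is a family of stencil coefficients `C_p(h)` of the scheme at the interior grid point `s`:
the sign-normalized form of a real solution of the interior equations whose (nonzero)
zeroth-order part has a positive central entry. -/
def IsInteriorCoeff (a : ℂ → ℝ) (h : ℝ) (s : ℂ) (C : ℤ × ℤ → ℝ) : Prop :=
  ∃ c : ℤ × ℤ → ℕ → ℝ, InteriorSystem (jet a s) c ∧ 0 < c (0, 0) 0 ∧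
    ∀ p ∈ refStencil, C p = modified (lamInterior refStencil c) c 7 h p

/-! ### The boundary curve -/

/-- `γ` is a regular `C⁵` parametrization of `∂Ω` near `b = γ t`: arbitrarily small parameter
intervals around `t` are mapped onto neighbourhoods of `b` in `∂Ω`. -/
def IsLocalParam (Ω : Set ℂ) (b : ℂ) (γ : ℝ → ℂ) (t : ℝ) : Prop :=
  γ t = b ∧ ContDiffAt ℝ 5 γ t ∧ deriv γ t ≠ 0 ∧ map γ (𝓝 t) = 𝓝[frontier Ω] b

/-- The tangent angle `θ = Arg γ'(t)`. -/
def tangentAngle (γ : ℝ → ℂ) (t : ℝ) : ℝ := (deriv γ t).arg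

/-- The line through `b` with direction angle `θ`. -/
def line (b : ℂ) (θ : ℝ) : Set ℂ := {q | ∃ r : ℝ, q = b + r * Complex.exp (θ * Complex.I)}

/-- The open half plane to the left of the line through `b` with direction angle `θ`. -/
def leftHalfPlane (b : ℂ) (θ : ℝ) : Set ℂ :=
  {q | 0 < ((q - b) * Complex.exp (-(θ * Complex.I))).im}

/-- The points of `∂Ω ∩ (s + [-h, h]²)` seen from `s` in a horizontal, vertical or `± 45°`
direction. -/
def rayPts (Ω : Set ℂ) (h : ℝ) (s : ℂ) : Set ℂ :=
  {b | b ∈ frontier Ω ∩ square s h ∧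
    ((b - s).re = 0 ∨ (b - s).im = 0 ∨ |(b - s).re| = |(b - s).im|)}

/-- `b` is an allowed base point for the boundary grid point `s`: it is a point of
`∂Ω ∩ (s + [-h, h]²)`, and it is a closest one among those seen from `s` in a horizontal, vertical
or `± 45°` direction as soon as there are such points. -/
def IsBasePoint (Ω : Set ℂ) (h : ℝ) (s b : ℂ) : Prop :=
  b ∈ frontier Ω ∩ square s h ∧
    ((rayPts Ω h s).Nonempty → b ∈ rayPts Ω h s ∧ ∀ b' ∈ rayPts Ω h s, ‖b - s‖ ≤ ‖b' - s‖)

/-- `z_j = γ^{(j+1)}(t) / (j+1)!`. -/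
def curveZ (γ : ℝ → ℂ) (t : ℝ) (j : ℕ) : ℂ :=
  iteratedDeriv (j + 1) γ t / ((j + 1).factorial : ℂ)

/-- The numbers `N^{k,l}_j`, defined recursively from `z_0, z_1, …`. -/
def curveN (z : ℕ → ℂ) : ℕ → ℕ → ℕ → ℂ
  | 0, 0, j => if j = 0 then 1 else 0
  | 0, l + 1, j =>
      1 / ((l : ℂ) + 1) * ∑ n ∈ Finset.range (j + 1), curveN z 0 l n * starRingEnd ℂ (z (j - n))
  | k + 1, l, j =>
      1 / ((k : ℂ) + 1) * ∑ n ∈ Finset.range (j + 1), curveN z k l n * z (j - n)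

/-- `B̃_{m,n}`. -/
def curveBTilde (D : ℕ → ℕ → ℂ) (z : ℕ → ℂ) (θ : ℝ) (m n : ℕ) : ℂ :=
  ∑ j ∈ Finset.Icc n m, ∑ l ∈ Finset.range (m - j + 1),
    curveN z j (m - l - j) l * bigATilde D n 0 j (m - l - j) *
      Complex.exp (-(n * θ * Complex.I))

/-- `B_{m,n} = m!/|z_0|^m [Im B̃_{m,n} - ∑_{l=n+1}^{m-1} Re(B̃_{m,l}) B_{l,n}]`. -/
def curveB (D : ℕ → ℕ → ℂ) (z : ℕ → ℂ) (θ : ℝ) (n : ℕ) (m : ℕ) : ℝ :=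
  (m.factorial : ℝ) / ‖z 0‖ ^ m *
    ((curveBTilde D z θ m n).im -
      ∑ l : Finset.Ioo n m, (curveBTilde D z θ m l).re * curveB D z θ n l)
termination_by m
decreasing_by exact (Finset.mem_Ioo.mp l.2).2

/-- `A^k_m(p) = -2 Im(A^k_{m,0}(p) e^{-imθ}) + ∑_{n=m+1}^{k} 2 Re(A^k_{n,0}(p) e^{-inθ}) B_{n,m}`. -/
def coefABoundary (D : ℕ → ℕ → ℂ) (z : ℕ → ℂ) (θ : ℝ) (k m : ℕ) (p : ℂ) : ℝ :=
  -2 * (coefA D k m p * Complex.exp (-(m * θ * Complex.I))).im +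
    ∑ n ∈ Finset.Icc (m + 1) k,
      2 * (coefA D k n p * Complex.exp (-(n * θ * Complex.I))).re * curveB D z θ m n

/-! ### Boundary stencils (`M = 4`) -/

/-- The symmetries of the square, acting on offsets: a reflection (if `f` holds) followed by `k`
quarter turns. -/
def sym (k : Fin 4) (f : Bool) (p : ℤ × ℤ) : ℤ × ℤ :=
  (fun q : ℤ × ℤ => (-q.2, q.1))^[(k : ℕ)] (if f then (p.1, -p.2) else p)

/-- The same symmetries acting on the plane. -/
def symC (k : Fin 4) (f : Bool) (w : ℂ) : ℂ :=
  Complex.I ^ (k : ℕ) * (if f then starRingEnd ℂ w else w)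

/-- The eight configurations of a boundary grid point with respect to `Ω` and the tangent line. -/
inductive BdryCase
  | I | II | III | IV | V | VI | VII | VIII

/-- The six types of boundary stencils. -/
inductive StencilType
  | one | two | three | four | five | six

/-- The points of the reference stencil that are not available (outside `Ω`, or not to the left of
the tangent line), in standard position. -/
def BdryCase.missing : BdryCase → Finset (ℤ × ℤ)
  | .I => {(-1, -1), (0, -1), (1, -1), (1, 0)}
  | .II => {(-1, -1), (0, -1), (1, -1)}
  | .III => {(0, -1), (1, -1), (1, 0)}
  | .IV => {(0, -1), (1, -1)}
  | .V => {(1, -1)}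
  | .VI => {(-1, -1), (0, -1), (1, -1), (-1, 0), (1, 0)}
  | .VII => {(-1, -1), (0, -1), (1, -1), (1, 0), (1, 1)}
  | .VIII => {(-1, -1), (1, -1)}

/-- The stencil type used in each case. -/
def BdryCase.type : BdryCase → StencilType
  | .I => .one
  | .II => .two
  | .III => .three
  | .IV => .two
  | .V => .four
  | .VI => .five
  | .VII => .six
  | .VIII => .two

/-- The stencils, in standard position. -/
def StencilType.stencil : StencilType → Finset (ℤ × ℤ)
  | .one => {(0, 0), (-1, 0), (-1, 1), (-1, 2), (0, 2), (1, 2), (1, 1)}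
  | .two => {(0, 0), (-1, 0), (-1, 1), (-1, 2), (0, 2), (1, 2), (1, 1), (1, 0)}
  | .three => {(0, 0), (-1, -1), (-1, 0), (-1, 1), (-2, 1), (-1, 2), (0, 1), (1, 1)}
  | .four => {(0, 0), (0, -1), (-1, -1), (-1, 0), (-1, 1), (0, 1), (1, 1), (1, 0)}
  | .five => {(0, 0), (-1, 1), (-1, 2), (0, 2), (1, 2), (1, 1)}
  | .six => {(0, 0), (-1, 0), (-2, 1), (-1, 1), (-1, 2), (0, 1)}

/-- The direction (in standard position) in which the point `C` of the tangent line is seen from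
the stencil center. -/
def StencilType.dir : StencilType → ℤ × ℤ
  | .one | .two | .five => (0, -1)
  | .three | .four | .six => (1, -1)

/-- The extra equations for the zeroth-order coefficients `c₀` (in standard position), besides
`c₀ (0, 0) = 1`. Here `r = |AC| / h`, and `θ` is the angle of the tangent line in standard
position. -/
def StencilType.ExtraEqs (r θ : ℝ) (c₀ : ℤ × ℤ → ℝ) : StencilType → Prop
  | .one => c₀ (-1, 0) - c₀ (1, 1) = -r / 4
  | .two => c₀ (-1, 0) - c₀ (1, 1) = -r / 5 ∧ c₀ (1, 0) - c₀ (-1, 1) = -r / 5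
  | .three =>
      c₀ (-1, -1) - c₀ (-1, 1) = -((1 + |Real.tan (θ - Real.pi / 4)|) * r) / (15 * √2) ∧
      c₀ (1, 1) - c₀ (-1, 1) = -((1 + |Real.tan (θ - Real.pi / 4)|) * r) / (15 * √2)
  | .four => c₀ (0, -1) - c₀ (1, 1) = 0 ∧ c₀ (1, 0) - c₀ (-1, -1) = 0
  | .five => True
  | .six => True

/-- The choices made by the scheme at a boundary grid point `s`. -/
structure BoundarySetup (Ω : Set ℂ) (h : ℝ) (s : ℂ) where
  /-- The base point on `∂Ω`. -/
  b : ℂ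
  isBase : IsBasePoint Ω h s b
  /-- A parametrization of `∂Ω` near the base point, directed so that `s` lies on its left. -/
  γ : ℝ → ℂ
  t : ℝ
  param : IsLocalParam Ω b γ t
  left : s ∈ leftHalfPlane b (tangentAngle γ t)
  /-- The configuration, and the symmetry that carries the standard position to the actual one. -/
  case : BdryCase
  k : Fin 4
  f : Bool
  pattern : ∀ p ∈ refStencil,
    s + h * toC (sym k f p) ∈ Ω ∩ leftHalfPlane b (tangentAngle γ t) ↔ p ∉ case.missing
  /-- The point `C` of the tangent line. -/
  C : ℂ
  C_mem : C ∈ line b (tangentAngle γ t)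
  C_ray : ∃ r : ℝ, 0 ≤ r ∧ C = s + r * h * toC (sym k f case.type.dir)
  /-- The direction angle of the tangent line in standard position. -/
  θ₀ : ℝ
  θ₀_spec : symC k f (Complex.exp (θ₀ * Complex.I)) =
    Complex.exp (tangentAngle γ t * Complex.I)

namespace BoundarySetup

variable {Ω : Set ℂ} {h : ℝ} {s : ℂ}

/-- The stencil, as a set of offsets. -/
def stencil (B : BoundarySetup Ω h s) : Finset (ℤ × ℤ) :=
  B.case.type.stencil.image (sym B.k B.f)

/-- The linear equations for the boundary coefficients `c_{p,j}`, `p` in the stencil,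
`0 ≤ j ≤ 4`; the functions `A^k_m` are evaluated at `p + (s - b) / h`. -/
def System (B : BoundarySetup Ω h s) (D : ℕ → ℕ → ℂ) (c : ℤ × ℤ → ℕ → ℝ) : Prop :=
  ∀ j m : ℕ, j ≤ 4 → 1 ≤ m → m ≤ 5 - j →
    -∑ p ∈ B.stencil, coefABoundary D (curveZ B.γ B.t) (tangentAngle B.γ B.t) m m
        (toC p + (s - B.b) / h) * c p j =
      ∑ k ∈ Finset.range j, ∑ p ∈ B.stencil,
        coefABoundary D (curveZ B.γ B.t) (tangentAngle B.γ B.t) (m + j - k) m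
          (toC p + (s - B.b) / h) * c p k

/-- `C` is a family of stencil coefficients `C_p(h)` of the scheme at the boundary grid point `s`,
for the given choices: the sign-normalized form of a real solution of the boundary equations whose
zeroth-order part satisfies the extra equations. -/
def IsCoeff (B : BoundarySetup Ω h s) (a : ℂ → ℝ) (C : ℤ × ℤ → ℝ) : Prop :=
  ∃ c : ℤ × ℤ → ℕ → ℝ, B.System (jet a B.b) c ∧ c (0, 0) 0 = 1 ∧
    B.case.type.ExtraEqs (‖B.C - s‖ / h) B.θ₀ (fun p => c (sym B.k B.f p) 0) ∧
    ∀ p ∈ B.stencil, C p = modified (lamBoundary B.stencil c) c 4 h p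

end BoundarySetup

/-! ### The difference operator -/

/-- `S s` and `C s p` (`p ∈ S s`) are the stencils and the coefficients `C_p(h)` of the sixth-order
scheme with mesh size `h` for `-∇·(a∇u) = f` in `Ω`, at all grid points `s`. -/
def IsScheme (Ω : Set ℂ) (a : ℂ → ℝ) (h : ℝ) (S : ℂ → Finset (ℤ × ℤ)) (C : ℂ → ℤ × ℤ → ℝ) :
    Prop :=
  (∀ s ∈ interiorPts Ω h, S s = refStencil ∧ IsInteriorCoeff a h s (C s)) ∧
  (∀ s ∈ boundaryPts Ω h, ∃ B : BoundarySetup Ω h s, S s = B.stencil ∧ B.IsCoeff a (C s))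

open Classical in
/-- `L_h v(s) = h^{-σ} ∑_{p ∈ S s} C_p(h) v(s + p h)`, with `σ = 2` at interior and `σ = 0` at
boundary grid points, for grid functions `v : Ω_h → ℝ`. (A stencil point outside `Ω_h` would not
contribute.) -/
def opL (Ω : Set ℂ) (h : ℝ) (S : ℂ → Finset (ℤ × ℤ)) (C : ℂ → ℤ × ℤ → ℝ)
    (v : gridPts Ω h → ℝ) (s : gridPts Ω h) : ℝ :=
  (if (s : ℂ) ∈ interiorPts Ω h then (h ^ 2)⁻¹ else 1) *
    ∑ p ∈ S s, C s p *
      (if hp : (s : ℂ) + h * toC p ∈ gridPts Ω h then v ⟨(s : ℂ) + h * toC p, hp⟩ else 0)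

end CompactFDM

end

/-! Everything reduces to signs: off-centre stencil coefficients are negative, and the coefficient
sum is zero at interior and positive at boundary grid points. Given this (`exists_min_of_signs`),
take a minimizer with largest real part. If it were interior, all its stencil neighbours would be
minimizers too, including the one to its right; so it is a boundary point, and there the positive
coefficient sum makes the minimum nonnegative.

The sign normalization multiplies `∑ c_{p,j} h^j` by the series `1 / (1 - ∑ λ_k h^k)` and truncates.
The `λ_k` are so large that every higher-order coefficient gets the sign of the zeroth-order one
(`sum_normalized_neg`). Hence only `c_{p,0}` matters, and its equations involve neither `a` nor the
curvature of the boundary, which is why `h₀` depends on `Ω` alone. At interior points they make the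
moments `∑ p^m c_p` vanish, which forces a multiple of the nine-point Laplacian
(`InteriorSystem.neg`). At boundary points they read `∑ c_p Im (w_p ^ m) = 0` for `1 ≤ m ≤ 5`, where
`w_p` is the position relative to the base point with the tangent turned onto the real axis; they
depend only on the tangent line `α x + β y + δ = 0` in standard position.

Cramer's rule turns the boundary signs into positivity of polynomials in `α, β, δ`
(`signs_of_certs`). In each configuration the possible lines fill one or two simplicial cones. On
such a cone `(α, β, δ)` is, up to scaling, `V₀ + u V₁ + v V₂` with `u, v ≥ 0`, and it suffices that
the polynomials in `u, v` have nonnegative coefficients and a positive constant term. This is read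
off from one huge integer by Kronecker substitution: for large bases `B`, `B'` the coefficients are
the digits of the value at `(B', B)`. The integers are computed by the kernel.

Geometry enters through `exists_nearlyFlat`: on a uniform scale, the boundary lies in a narrow
double cone around each of its tangents. Since the base point is a closest one, `s` lies outside
that cone; the sector on its side is connected and free of boundary points, hence contained in `Ω`.
So stencil points clearly to the left of the tangent are in `Ω`, and the pattern of missing points
locates the tangent up to an error of `1/100`. -/

namespace CompactFDM

/-! ### Integer polynomials in two variables as coefficient lists -/

/-- Addition of coefficient lists. -/
def listAdd {α : Type} (add : α → α → α) : List α → List α → List α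
  | [], q => q
  | a :: p, q =>
    match q with
    | [] => a :: p
    | b :: q => add a b :: listAdd add p q

/-- Multiplication of coefficient lists. -/
def listMul {α : Type} (zero : α) (add mul : α → α → α) : List α → List α → List α
  | [], _ => []
  | a :: p, q => listAdd add (q.map (mul a)) (zero :: listMul zero add mul p q)

/-- Evaluation of a coefficient list at `x`. -/
def listEval {α S : Type} [Semiring S] (ev : α → S) (x : S) : List α → S
  | [] => 0
  | a :: p => ev a + x * listEval ev x p

section listEval
variable {α S : Type} [CommRing S] {ev : α → S} {zero : α} {add mul : α → α → α}

theorem listEval_add (hadd : ∀ a b, ev (add a b) = ev a + ev b) (x : S) (p q : List α) :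
    listEval ev x (listAdd add p q) = listEval ev x p + listEval ev x q := by
  induction p generalizing q with
  | nil => simp [listAdd, listEval]
  | cons a p ih =>
    cases q with
    | nil => simp [listAdd, listEval]
    | cons b q => simp only [listAdd, listEval, hadd, ih]; ring

theorem listEval_map {f : α → α} {c : S} (hf : ∀ a, ev (f a) = c * ev a) (x : S) (p : List α) :
    listEval ev x (p.map f) = c * listEval ev x p := by
  induction p with
  | nil => simp [listEval]
  | cons a p ih => simp only [List.map_cons, listEval, hf, ih]; ring

theorem listEval_mul (hzero : ev zero = 0) (hadd : ∀ a b, ev (add a b) = ev a + ev b)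
    (hmul : ∀ a b, ev (mul a b) = ev a * ev b) (x : S) (p q : List α) :
    listEval ev x (listMul zero add mul p q) = listEval ev x p * listEval ev x q := by
  induction p with
  | nil => simp [listMul, listEval]
  | cons a p ih =>
    rw [listMul, listEval_add hadd, listEval_map (hmul a), listEval, hzero, ih, listEval]
    ring

end listEval

/-! ### Majorants: sums of absolute values of coefficients -/

section majorant
variable {α : Type} {mj : α → ℕ} {zero : α} {add mul : α → α → α}

/-- Cancellation can only decrease absolute values. Upper bounds are therefore enough, and they can
be propagated through a computation without knowing the coefficients. -/
theorem listEval_add_le (hadd : ∀ a b, mj (add a b) ≤ mj a + mj b) (x : ℕ) (p q : List α) :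
    listEval mj x (listAdd add p q) ≤ listEval mj x p + listEval mj x q := by
  induction p generalizing q with
  | nil => simp [listAdd, listEval]
  | cons a p ih =>
    cases q with
    | nil => simp [listAdd, listEval]
    | cons b q =>
      simp only [listAdd, listEval]
      nlinarith [hadd a b, Nat.mul_le_mul_left x (ih q)]

theorem listEval_map_le {f : α → α} {c : ℕ} (hf : ∀ a, mj (f a) ≤ c * mj a) (x : ℕ)
    (p : List α) : listEval mj x (p.map f) ≤ c * listEval mj x p := by
  induction p with
  | nil => simp [listEval]
  | cons a p ih =>
    simp only [List.map_cons, listEval]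
    nlinarith [hf a, Nat.mul_le_mul_left x ih]

theorem listEval_mul_le (hzero : mj zero = 0) (hadd : ∀ a b, mj (add a b) ≤ mj a + mj b)
    (hmul : ∀ a b, mj (mul a b) ≤ mj a * mj b) (x : ℕ) (p q : List α) :
    listEval mj x (listMul zero add mul p q) ≤ listEval mj x p * listEval mj x q := by
  induction p with
  | nil => simp [listMul, listEval]
  | cons a p ih =>
    rw [listMul]
    refine (listEval_add_le hadd _ _ _).trans ?_
    simp only [listEval, hzero]
    nlinarith [listEval_map_le (hmul a) x q, Nat.mul_le_mul_left x ih]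

end majorant

/-- Integer polynomials in two variables. -/
structure Poly where
  /-- The list of coefficients, in powers of the first variable. -/
  coeffs : List (List ℤ)

namespace Poly

instance : Zero Poly := ⟨⟨[]⟩⟩
instance : One Poly := ⟨⟨[[1]]⟩⟩
instance : Add Poly := ⟨fun p q => ⟨listAdd (listAdd Int.add) p.coeffs q.coeffs⟩⟩
instance : Mul Poly :=
  ⟨fun p q => ⟨listMul [] (listAdd Int.add) (listMul 0 Int.add Int.mul) p.coeffs q.coeffs⟩⟩
instance : IntCast Poly := ⟨fun n => ⟨[[n]]⟩⟩
instance : Neg Poly := ⟨fun p => ⟨p.coeffs.map (List.map Int.neg)⟩⟩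

section eval
variable {S : Type} [CommRing S]

/-- The value of a polynomial. -/
def eval (u v : S) (p : Poly) : S := listEval (listEval (fun n : ℤ => (n : S)) v) u p.coeffs

variable (u v : S)

theorem eval_zero : eval u v 0 = 0 := rfl

theorem eval_intCast (n : ℤ) : eval u v n = n := by
  change listEval _ _ [[n]] = _
  simp [listEval]

theorem eval_one : eval u v 1 = 1 := (eval_intCast u v 1).trans Int.cast_one

theorem eval_add (p q : Poly) : eval u v (p + q) = eval u v p + eval u v q :=
  listEval_add (listEval_add (fun a b => Int.cast_add a b) v) u _ _

theorem eval_mul (p q : Poly) : eval u v (p * q) = eval u v p * eval u v q :=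
  listEval_mul (ev := listEval (fun n : ℤ => (n : S)) v) rfl
    (listEval_add (fun a b => Int.cast_add a b) v)
    (listEval_mul Int.cast_zero (fun a b => Int.cast_add a b) (fun a b => Int.cast_mul a b) v) u _ _

theorem eval_neg (p : Poly) : eval u v (-p) = -eval u v p := by
  have h1 : ∀ q : List ℤ, listEval (fun n : ℤ => (n : S)) v (q.map Int.neg) =
      -1 * listEval (fun n : ℤ => (n : S)) v q :=
    listEval_map (fun a => (Int.cast_neg a).trans (neg_one_mul _).symm) v
  have h2 := listEval_map h1 u p.coeffs
  rw [neg_one_mul] at h2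
  exact h2

end eval

/-- The value at `(1, y)` of the polynomial with the absolute values of the coefficients. -/
def maj (y : ℕ) (p : Poly) : ℕ := listEval (listEval Int.natAbs y) 1 p.coeffs

variable (y : ℕ)

theorem maj_intCast (n : ℤ) : maj y n = n.natAbs := by
  change listEval _ _ [[n]] = _
  simp [listEval]

theorem maj_add (p q : Poly) : maj y (p + q) ≤ maj y p + maj y q :=
  listEval_add_le (listEval_add_le Int.natAbs_add_le y) 1 _ _

theorem maj_mul (p q : Poly) : maj y (p * q) ≤ maj y p * maj y q :=
  listEval_mul_le (mj := listEval Int.natAbs y) rfl (listEval_add_le Int.natAbs_add_le y)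
    (listEval_mul_le Int.natAbs_zero Int.natAbs_add_le
      (fun a b => (Int.natAbs_mul a b).le) y) 1 _ _

theorem maj_neg (p : Poly) : maj y (-p) ≤ maj y p := by
  have h1 : ∀ q : List ℤ, listEval Int.natAbs y (q.map Int.neg) ≤ 1 * listEval Int.natAbs y q :=
    listEval_map_le (fun a => by rw [one_mul]; exact (Int.natAbs_neg a).le) y
  have h2 := listEval_map_le h1 1 p.coeffs
  rw [one_mul] at h2
  exact h2

end Poly

/-! ### Reading off coefficients from one value -/

/-- The digits of `n` to the base `B` are less than `B / 2` and satisfy `P`, and there are at most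
`k` of them. -/
def smallDigits (B : ℤ) (P : ℤ → Bool) : ℕ → ℤ → Bool
  | 0, n => decide (n = 0)
  | k + 1, n => decide (2 * (n % B) < B) && P (n % B) && smallDigits B P k (n / B)

theorem smallDigits_zero {B : ℤ} (hB : 0 < B) {P : ℤ → Bool} (hP : P 0 = true) (k : ℕ) :
    smallDigits B P k 0 = true := by
  induction k with
  | zero => simp [smallDigits]
  | succ k ih => simp [smallDigits, hP, ih, hB]

/-- `c` and `n % B` differ by a multiple of `B`, but both are less than `B / 2` in absolute value.
The bound on the digit thus excludes a negative `c`, which would show up as a digit above `B / 2`.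
-/
theorem eq_emod_ediv_of_small {B c d n : ℤ} (hn : n = c + B * d) (hc : 2 * |c| < B)
    (hd : 2 * (n % B) < B) : c = n % B ∧ d = n / B := by
  have hB : 0 < B := by linarith [abs_nonneg c]
  have h1 := Int.emod_nonneg n hB.ne'
  have h2 : B ∣ c - n % B := ⟨n / B - d, by
    have := Int.emod_add_mul_ediv n B
    linear_combination -hn - this⟩
  have h3 : c - n % B = 0 := by
    refine Int.eq_zero_of_abs_lt_dvd h2 ?_
    rw [abs_lt]
    constructor <;> linarith [neg_abs_le c, le_abs_self c]
  refine ⟨by linarith, ?_⟩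
  have := Int.emod_add_mul_ediv n B
  have : B * d = B * (n / B) := by linarith
  exact mul_left_cancel₀ hB.ne' this

/-- The digit test knows only the value, not the list. Trailing zero coefficients may make the list
longer than the number `k` of digits, hence the assumption `P 0`. -/
theorem forall_of_smallDigits {α : Type} {ev : α → ℤ} {B : ℤ} {P : ℤ → Bool} (hP : P 0 = true)
    {p : List α} (hB : ∀ a ∈ p, 2 * |ev a| < B) {k : ℕ}
    (h : smallDigits B P k (listEval ev B p) = true) : ∀ a ∈ p, P (ev a) = true ∧ 0 ≤ ev a := by
  induction p generalizing k with
  | nil => simp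
  | cons a p ih =>
    have ha := hB a (by simp)
    have hB0 : 0 < B := by linarith [abs_nonneg (ev a)]
    have key : (P (ev a) = true ∧ 0 ≤ ev a) ∧ ∃ k, smallDigits B P k (listEval ev B p) = true := by
      cases k with
      | zero =>
        simp only [smallDigits, decide_eq_true_eq] at h
        have := eq_emod_ediv_of_small (n := 0) (by rw [← h, listEval]) ha (by simpa using hB0)
        simp only [Int.zero_emod, Int.zero_ediv] at this
        rw [this.1, this.2]
        exact ⟨⟨hP, le_rfl⟩, 0, by simp [smallDigits]⟩
      | succ k =>
        simp only [smallDigits, Bool.and_eq_true, decide_eq_true_eq] at h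
        have := eq_emod_ediv_of_small (by rw [listEval]) ha h.1.1
        rw [this.1, this.2]
        exact ⟨⟨h.1.2, Int.emod_nonneg _ hB0.ne'⟩, k, h.2⟩
    intro b hb
    rcases List.mem_cons.1 hb with rfl | hb
    · exact key.1
    · exact ih (fun a ha => hB a (List.mem_cons_of_mem _ ha)) key.2.choose_spec b hb

theorem natAbs_listEval_le {α : Type} {ev : α → ℤ} {mj : α → ℕ} (h : ∀ a, |ev a| ≤ mj a)
    (x : ℕ) (p : List α) : |listEval ev x p| ≤ listEval mj x p := by
  induction p with
  | nil => simp [listEval]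
  | cons a p ih =>
    simp only [listEval, Nat.cast_add, Nat.cast_mul]
    refine (abs_add_le _ _).trans (add_le_add (h a) ?_)
    rw [abs_mul, Nat.abs_cast]
    gcongr

theorem le_listEval_one {α : Type} {mj : α → ℕ} {x : ℕ} (hx : 1 ≤ x) {a : α} {p : List α}
    (ha : a ∈ p) : mj a ≤ listEval mj x p := by
  induction p with
  | nil => simp at ha
  | cons b p ih =>
    simp only [listEval]
    rcases List.mem_cons.1 ha with rfl | ha
    · exact Nat.le_add_right _ _
    · nlinarith [ih ha, Nat.zero_le (mj b), Nat.zero_le (listEval mj x p)]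

theorem listEval_nonneg {α : Type} {ev : α → ℝ} {x : ℝ} (hx : 0 ≤ x) {p : List α}
    (h : ∀ a ∈ p, 0 ≤ ev a) : 0 ≤ listEval ev x p := by
  induction p with
  | nil => simp [listEval]
  | cons a p ih =>
    exact add_nonneg (h a (by simp))
      (mul_nonneg hx (ih fun b hb => h b (List.mem_cons_of_mem _ hb)))

/-- A value of a polynomial at a large point, together with bounds for the coefficients. -/
structure Packed where
  /-- The value at `(B', B)`. -/
  val : ℤ
  /-- A bound for the sum of the absolute values of the coefficients. -/
  fst : ℕ
  /-- A bound for the value at `(1, B)` of the sum of the absolute values of the terms. -/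
  snd : ℕ

namespace Packed

instance : Zero Packed := ⟨⟨0, 0, 0⟩⟩
instance : One Packed := ⟨⟨1, 1, 1⟩⟩
instance : Add Packed := ⟨fun p q => ⟨p.val + q.val, p.fst + q.fst, p.snd + q.snd⟩⟩
instance : Mul Packed := ⟨fun p q => ⟨p.val * q.val, p.fst * q.fst, p.snd * q.snd⟩⟩
instance : Neg Packed := ⟨fun p => ⟨-p.val, p.fst, p.snd⟩⟩
instance : IntCast Packed := ⟨fun n => ⟨n, n.natAbs, n.natAbs⟩⟩

/-- `x` is obtained from the polynomial `p` with bases `B` and `B'`. -/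
def Rep (B B' : ℕ) (p : Poly) (x : Packed) : Prop :=
  p.eval (B' : ℤ) (B : ℤ) = x.val ∧ p.maj 1 ≤ x.fst ∧ p.maj B ≤ x.snd

/-- A sufficient condition for the coefficients of the polynomial to be nonnegative, and the
constant one positive. -/
def isPos (B B' k : ℕ) (x : Packed) : Bool :=
  decide (2 * x.fst < B) && decide (2 * x.snd < B') &&
    smallDigits B' (fun n => smallDigits B (fun _ => true) k n) k x.val &&
    decide (0 < x.val % B' % B)

/-- Digits are extracted twice. In base `B'` they are the values at `B` of the inner coefficient
lists, bounded through `snd`; in base `B` the digits of these are the coefficients themselves,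
bounded through `fst`. -/
theorem Rep.eval_pos {B B' k : ℕ} {p : Poly} {x : Packed} (h : Rep B B' p x)
    (hx : x.isPos B B' k = true) {u v : ℝ} (hu : 0 ≤ u) (hv : 0 ≤ v) : 0 < p.eval u v := by
  simp only [isPos, Bool.and_eq_true, decide_eq_true_eq] at hx
  obtain ⟨⟨⟨h1, h2⟩, h3⟩, h4⟩ := hx
  obtain ⟨e0, e1, e2⟩ := h
  have hB : 1 ≤ B := by omega
  rw [← e0] at h3 h4
  have b1 : ∀ q ∈ p.coeffs, ∀ c ∈ q, 2 * |c| < (B : ℤ) := fun q hq c hc => by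
    have := (le_listEval_one (mj := Int.natAbs) le_rfl hc).trans
      (le_listEval_one (mj := listEval Int.natAbs 1) le_rfl hq)
    have h6 := Int.natCast_natAbs c
    have h5 : listEval (listEval Int.natAbs 1) 1 p.coeffs = p.maj 1 := rfl
    omega
  have b2 : ∀ q ∈ p.coeffs, 2 * |listEval (fun n : ℤ => (n : ℤ)) (B : ℤ) q| < (B' : ℤ) :=
    fun q hq => by
      have h5 := natAbs_listEval_le (ev := fun n : ℤ => (n : ℤ)) (mj := Int.natAbs)
        (fun a => (Int.natCast_natAbs a).ge) B q
      have h6 := le_listEval_one (mj := listEval Int.natAbs B) le_rfl hq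
      have h7 : listEval (listEval Int.natAbs B) 1 p.coeffs = p.maj B := rfl
      omega
  have c1 := forall_of_smallDigits (smallDigits_zero (by omega) rfl k) b2 h3
  have c2 : ∀ q ∈ p.coeffs, ∀ c ∈ q, 0 ≤ c := fun q hq c hc =>
    (forall_of_smallDigits (ev := fun n : ℤ => (n : ℤ)) rfl (b1 q hq) (c1 q hq).1 c hc).2
  have c3 : ∀ q ∈ p.coeffs, 0 ≤ listEval (fun n : ℤ => (n : ℝ)) v q := fun q hq =>
    listEval_nonneg hv fun c hc => by exact_mod_cast c2 q hq c hc
  obtain ⟨_ | ⟨q, r⟩⟩ := p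
  · simp [Poly.eval, listEval] at h4
  have c4 : 0 ≤ listEval (listEval (fun n : ℤ => (n : ℝ)) v) u r :=
    listEval_nonneg hu fun a ha => c3 a (List.mem_cons_of_mem _ ha)
  refine add_pos_of_pos_of_nonneg ?_ (mul_nonneg hu c4)
  have c5 : listEval (fun n : ℤ => n) (B : ℤ) q % B' = listEval (fun n : ℤ => n) (B : ℤ) q :=
    Int.emod_eq_of_lt (c1 q List.mem_cons_self).2
      (by linarith [b2 q List.mem_cons_self, abs_nonneg (listEval (fun n : ℤ => n) (B : ℤ) q),
        le_abs_self (listEval (fun n : ℤ => n) (B : ℤ) q)])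
  have c6 : Poly.eval (B' : ℤ) (B : ℤ) ⟨q :: r⟩ % B' = listEval (fun n : ℤ => n) (B : ℤ) q := by
    rw [← c5]
    exact Int.add_mul_emod_self_left _ _ _
  rw [c6] at h4
  obtain _ | ⟨c, q⟩ := q
  · simp [listEval] at h4
  have c7 : 0 < c := by
    rw [listEval, Int.add_mul_emod_self_left] at h4
    have := b1 _ List.mem_cons_self c List.mem_cons_self
    have h8 := c2 _ List.mem_cons_self c List.mem_cons_self
    rcases h8.eq_or_lt with h9 | h9
    · simp [← h9] at h4
    · exact h9
  refine add_pos_of_pos_of_nonneg (Int.cast_pos.2 c7) (mul_nonneg hv ?_)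
  exact listEval_nonneg hv fun d hd => by
    exact_mod_cast c2 _ List.mem_cons_self d (List.mem_cons_of_mem _ hd)

end Packed

/-! ### Determinants by row expansion -/

/-- The sum of the values of a function on `Fin n`. -/
def finSum {R : Type} [Zero R] [Add R] : (n : ℕ) → (Fin n → R) → R
  | 0, _ => 0
  | n + 1, f => f 0 + finSum n (fun i => f i.succ)

/-- The determinant, expanded along the first row. -/
def rowDet {R : Type} [Zero R] [One R] [Add R] [Mul R] [Neg R] :
    (n : ℕ) → (Fin n → Fin n → R) → R
  | 0, _ => 1
  | n + 1, M => finSum (n + 1) fun j =>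
      bif j.val % 2 == 0 then M 0 j * rowDet n (fun i k => M i.succ (j.succAbove k))
      else -(M 0 j * rowDet n (fun i k => M i.succ (j.succAbove k)))

theorem finSum_eq_sum {R : Type} [AddCommMonoid R] (n : ℕ) (f : Fin n → R) :
    finSum n f = ∑ i, f i := by
  induction n with
  | zero => simp [finSum]
  | succ n ih => rw [finSum, ih, Fin.sum_univ_succ]

/-- `rowDet` needs only the operations, no ring laws, so the same expression can be evaluated on
`Packed` and on `Poly`. Over an actual ring it may be replaced by `Matrix.det`, for which Cramer's
rule is available. -/
theorem rowDet_eq_det {R : Type} [CommRing R] (n : ℕ) (M : Fin n → Fin n → R) :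
    rowDet n M = (Matrix.of M).det := by
  induction n with
  | zero => simp [rowDet]
  | succ n ih =>
    rw [rowDet, finSum_eq_sum, Matrix.det_succ_row_zero]
    refine Finset.sum_congr rfl fun j _ => ?_
    rw [ih]
    rcases Nat.even_or_odd j.val with h | h
    · rw [h.neg_one_pow, Nat.even_iff.1 h]
      simp [Matrix.submatrix]
    · rw [h.neg_one_pow, Nat.odd_iff.1 h]
      simp [Matrix.submatrix]

/-! ### The zeroth-order boundary equations -/

/-- The data of a system of equations for the zeroth-order boundary coefficients. The extra
equations are `c p = c (unknown i) - σ δ / (L ρ ^ 2)` for `(p, i)` in `merged`, where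
`ρ = root.1 α + root.2 β` and `σ = shift.1 α + shift.2 β`. -/
structure OddSystem where
  /-- The offsets of the unknown coefficients. -/
  unknown : Fin 5 → ℤ × ℤ
  /-- The offsets of the coefficients that the extra equations eliminate. -/
  merged : List ((ℤ × ℤ) × Fin 5)
  /-- The constant `L`. -/
  scale : ℕ
  /-- The coefficients of the linear form `ρ`. -/
  root : ℤ × ℤ
  /-- The coefficients of the linear form `σ`. -/
  shift : ℤ × ℤ

section ring
variable {R : Type} [Zero R] [One R] [Add R] [Mul R] [Neg R] [IntCast R]

/-- The real polynomials `Im (w ^ m) / Im w` for `w = X + iY` and `m = 5, 4, 3, 2, 1`, the one for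
`m = 4` divided by `4` and the one for `m = 2` divided by `2`. -/
def oddFactor (X Y : R) : Fin 5 → R
  | 0 => ((5 : ℤ) : R) * (X * X * X * X) + -(((10 : ℤ) : R) * (X * X * (Y * Y))) + Y * Y * Y * Y
  | 1 => X * (X * X + -(Y * Y))
  | 2 => ((3 : ℤ) : R) * (X * X) + -(Y * Y)
  | 3 => X
  | 4 => 1

/-- The linear form `x α + y β`. -/
def linForm (α β : R) (p : ℤ × ℤ) : R := (p.1 : R) * α + (p.2 : R) * β

/-- Values at the offset `p` of the harmonic polynomials that are odd with respect to the line
`x α + y β + δ = 0`. -/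
def oddHarmonic (α β δ : R) (p : ℤ × ℤ) (m : Fin 5) : R :=
  (linForm α β p + δ) * oddFactor (linForm β (-α) p) (linForm α β p + δ) m

namespace OddSystem
variable (E : OddSystem) (α β δ : R)

/-- The entries of the coefficient matrix. -/
def entry (m i : Fin 5) : R :=
  oddHarmonic α β δ (E.unknown i) m +
    (E.merged.map fun x => bif x.2 == i then oddHarmonic α β δ x.1 m else 0).sum

/-- The right-hand sides. -/
def rhs (m : Fin 5) : R :=
  -(((E.scale : ℤ) : R) * (linForm α β E.root * linForm α β E.root) * oddFactor 0 δ m) +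
    linForm α β E.shift * (E.merged.map fun x => oddHarmonic α β δ x.1 m).sum

/-- The determinant of the system. -/
def den : R := rowDet 5 (E.entry α β δ)

/-- The numerators of Cramer's rule. -/
def num (i : Fin 5) : R :=
  rowDet 5 fun m j => bif j == i then E.rhs α β δ m else E.entry α β δ m j

/-- The quantities whose positivity gives the signs of the solution. -/
def certs : List R :=
  [E.den α β δ,
    (E.den α β δ *
      (((E.scale : ℤ) : R) * (linForm α β E.root * linForm α β E.root)) +
      δ * (finSum 5 (E.num α β δ) + (E.merged.map fun x =>
        E.num α β δ x.2 + -(linForm α β E.shift * E.den α β δ)).sum))] ++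
  (List.finRange 5).map (fun i => -E.num α β δ i) ++
  E.merged.map fun x =>
    -(E.num α β δ x.2 + -(linForm α β E.shift * E.den α β δ))

end OddSystem

end ring

/-! ### Signs of the solution -/

namespace OddSystem
variable (E : OddSystem) (α β δ : ℝ)

/-- After the extra equations have been substituted, five unknowns remain in five equations.
Cramer's rule expresses their signs, those of the merged coefficients and that of the total sum by
the polynomials in `certs`. -/
theorem signs_of_certs (c : ℤ × ℤ → ℝ) (hδ : 0 < δ) (hρ : 0 < linForm α β E.root)
    (hL : 0 < E.scale)
    (hsys : ∀ m, ∑ i, c (E.unknown i) * oddHarmonic α β δ (E.unknown i) m +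
      (E.merged.map fun x => c x.1 * oddHarmonic α β δ x.1 m).sum + δ * oddFactor 0 δ m = 0)
    (hmer : ∀ x ∈ E.merged, c x.1 = c (E.unknown x.2) -
      linForm α β E.shift * δ / (E.scale * linForm α β E.root ^ 2))
    (hcert : ∀ x ∈ E.certs α β δ, 0 < x) :
    (∀ i, c (E.unknown i) < 0) ∧ (∀ x ∈ E.merged, c x.1 < 0) ∧
      0 < 1 + ∑ i, c (E.unknown i) + (E.merged.map fun x => c x.1).sum := by
  have hL' : (0 : ℝ) < E.scale := by exact_mod_cast hL
  set ρ := linForm α β E.root with hρdef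
  set σ := linForm α β E.shift with hσ
  -- Multiplying the coefficients by `K` removes the factor `δ` of the central term and clears the
  -- denominator of the extra equations, so that the system for `d = c K` is polynomial in `α, β,
  -- δ`.
  set K := E.scale * ρ ^ 2 / δ with hK
  have hKpos : 0 < K := by positivity
  set d : Fin 5 → ℝ := fun i => c (E.unknown i) * K with hd
  have hmer' : ∀ x ∈ E.merged, c x.1 * K = d x.2 - σ := fun x hx => by
    rw [hmer x hx, hd, hK]
    field_simp
  have hlin : (Matrix.of (E.entry α β δ)).mulVec d = E.rhs α β δ := by
    funext m
    have h1 : ∑ i, (E.merged.map fun x => bif x.2 == i then oddHarmonic α β δ x.1 m else 0).sum *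
        d i = (E.merged.map fun x => oddHarmonic α β δ x.1 m * d x.2).sum := by
      induction E.merged with
      | nil => simp
      | cons x l ih =>
        simp only [List.map_cons, List.sum_cons, add_mul, Finset.sum_add_distrib, ih]
        congr 1
        rw [Finset.sum_eq_single x.2]
        · simp
        · intro i _ hi
          rw [beq_eq_false_iff_ne.2 hi.symm]; simp
        · simp
    have h2 : (E.merged.map fun x => c x.1 * oddHarmonic α β δ x.1 m).sum * K =
        (E.merged.map fun x => oddHarmonic α β δ x.1 m * d x.2).sum -
          σ * (E.merged.map fun x => oddHarmonic α β δ x.1 m).sum := by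
      rw [← List.sum_map_mul_right, ← List.sum_map_mul_left, eq_sub_iff_add_eq,
        ← List.sum_map_add]
      refine congrArg _ (List.map_congr_left fun x hx => ?_)
      linear_combination oddHarmonic α β δ x.1 m * hmer' x hx
    have h3 := congrArg (· * K) (hsys m)
    simp only [add_mul, h2, zero_mul] at h3
    have h4 : δ * oddFactor 0 δ m * K = E.scale * (ρ * ρ) * oddFactor 0 δ m := by
      rw [hK]; field_simp
    have h5 : (∑ i, c (E.unknown i) * oddHarmonic α β δ (E.unknown i) m) * K =
        ∑ i, oddHarmonic α β δ (E.unknown i) m * d i := by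
      rw [Finset.sum_mul]
      exact Finset.sum_congr rfl fun i _ => by rw [hd]; ring
    rw [Matrix.mulVec, dotProduct]
    simp only [Matrix.of_apply, entry, add_mul, Finset.sum_add_distrib, h1]
    rw [rhs, ← hρdef, ← hσ, Int.cast_natCast]
    rw [h4, h5] at h3
    linarith
  have hcramer : ∀ i, E.den α β δ * d i = E.num α β δ i := fun i => by
    have h1 := congrFun (Matrix.cramer_eq_adjugate_mulVec (Matrix.of (E.entry α β δ))
      (E.rhs α β δ)) i
    rw [← hlin, Matrix.mulVec_mulVec, Matrix.adjugate_mul, hlin, Matrix.cramer_apply,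
      Matrix.smul_mulVec, Matrix.one_mulVec] at h1
    rw [den, num, rowDet_eq_det, rowDet_eq_det]
    refine Eq.trans h1.symm (congrArg _ ?_)
    ext m j
    rw [Matrix.updateCol_apply]
    change _ = bif j == i then E.rhs α β δ m else E.entry α β δ m j
    by_cases h : j = i
    · simp [h]
    · rw [beq_eq_false_iff_ne.2 h, if_neg h]
      rfl
  simp only [certs, List.mem_append, List.mem_cons, List.mem_map, List.not_mem_nil, or_false]
    at hcert
  have hden := hcert _ (Or.inl (Or.inl (Or.inl rfl)))
  have htot := hcert _ (Or.inl (Or.inl (Or.inr rfl)))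
  have hnum : ∀ i, 0 < -E.num α β δ i := fun i =>
    hcert _ (Or.inl (Or.inr ⟨i, List.mem_finRange i, rfl⟩))
  have hnum' : ∀ x ∈ E.merged, 0 < -(E.num α β δ x.2 + -(σ * E.den α β δ)) :=
    fun x hx => hcert _ (Or.inr ⟨x, hx, rfl⟩)
  have hsign : ∀ y : ℝ, 0 < -(E.den α β δ * (y * K)) → y < 0 := fun y hy => by
    by_contra hy0
    push Not at hy0
    have : 0 ≤ E.den α β δ * (y * K) := by positivity
    linarith
  refine ⟨fun i => hsign _ ?_, fun x hx => hsign _ ?_, ?_⟩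
  · have := hnum i
    rwa [← hcramer] at this
  · have := hnum' x hx
    rw [← hcramer] at this
    rw [hmer' x hx]
    convert this using 3
    ring
  · have h1 : (E.merged.map fun x => E.num α β δ x.2 + -(σ * E.den α β δ)).sum =
        E.den α β δ * ((E.merged.map fun x => c x.1).sum * K) := by
      rw [← List.sum_map_mul_right, ← List.sum_map_mul_left]
      refine congrArg _ (List.map_congr_left fun x hx => ?_)
      rw [hmer' x hx, ← hcramer]
      ring
    have h2 : finSum 5 (E.num α β δ) = E.den α β δ * ((∑ i, c (E.unknown i)) * K) := by
      rw [finSum_eq_sum, Finset.sum_mul, Finset.mul_sum]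
      exact Finset.sum_congr rfl fun i _ => (hcramer i).symm
    have h3 : (((E.scale : ℤ) : ℝ) * (ρ * ρ)) = δ * K := by
      rw [hK, Int.cast_natCast]
      field_simp
    -- The second certificate is `den * δ * K` times the sum of all coefficients.
    rw [← hσ, ← hρdef, h1, h2, h3] at htot
    by_contra hy0
    push Not at hy0
    have : E.den α β δ * (δ * K) *
        (1 + ∑ i, c (E.unknown i) + (E.merged.map fun x => c x.1).sum) ≤ 0 :=
      mul_nonpos_of_nonneg_of_nonpos (by positivity) hy0
    nlinarith

end OddSystem

/-! ### Transfer of the sign conditions to one value of the polynomials -/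

/-- A relation that is compatible with the ring operations. -/
structure RingRel {R S : Type} [Zero R] [One R] [Add R] [Mul R] [Neg R] [IntCast R]
    [Zero S] [One S] [Add S] [Mul S] [Neg S] [IntCast S] (rel : R → S → Prop) : Prop where
  zero : rel 0 0
  one : rel 1 1
  intCast : ∀ n : ℤ, rel n n
  add : ∀ {a b x y}, rel a x → rel b y → rel (a + b) (x + y)
  mul : ∀ {a b x y}, rel a x → rel b y → rel (a * b) (x * y)
  neg : ∀ {a x}, rel a x → rel (-a) (-x)

namespace RingRel
variable {R S : Type} [Zero R] [One R] [Add R] [Mul R] [Neg R] [IntCast R]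
  [Zero S] [One S] [Add S] [Mul S] [Neg S] [IntCast S] {rel : R → S → Prop} (h : RingRel rel)
include h

theorem finSum {n : ℕ} {f : Fin n → R} {f' : Fin n → S} (hf : ∀ i, rel (f i) (f' i)) :
    rel (finSum n f) (CompactFDM.finSum n f') := by
  induction n with
  | zero => exact h.zero
  | succ n ih => exact h.add (hf 0) (ih fun i => hf i.succ)

theorem listSum {ι : Type} (l : List ι) {f : ι → R} {f' : ι → S} (hf : ∀ i, rel (f i) (f' i)) :
    rel (l.map f).sum (l.map f').sum := by
  induction l with
  | nil => exact h.zero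
  | cons a l ih => exact h.add (hf a) ih

theorem rowDet {n : ℕ} {M : Fin n → Fin n → R} {M' : Fin n → Fin n → S}
    (hM : ∀ i j, rel (M i j) (M' i j)) : rel (rowDet n M) (CompactFDM.rowDet n M') := by
  induction n with
  | zero => exact h.one
  | succ n ih =>
    refine h.finSum fun j => ?_
    have h1 := h.mul (hM 0 j) (ih fun i k => hM i.succ (j.succAbove k))
    cases j.val % 2 == 0
    · exact h.neg h1
    · exact h1

theorem oddFactor {X Y : R} {X' Y' : S} (hX : rel X X') (hY : rel Y Y') (m : Fin 5) :
    rel (oddFactor X Y m) (CompactFDM.oddFactor X' Y' m) := by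
  fin_cases m
  · exact h.add (h.add (h.mul (h.intCast 5) (h.mul (h.mul (h.mul hX hX) hX) hX))
      (h.neg (h.mul (h.intCast 10) (h.mul (h.mul hX hX) (h.mul hY hY)))))
      (h.mul (h.mul (h.mul hY hY) hY) hY)
  · exact h.mul hX (h.add (h.mul hX hX) (h.neg (h.mul hY hY)))
  · exact h.add (h.mul (h.intCast 3) (h.mul hX hX)) (h.neg (h.mul hY hY))
  · exact hX
  · exact h.one

variable {α β δ : R} {α' β' δ' : S} (hα : rel α α') (hβ : rel β β') (hδ : rel δ δ')

include hα hβ in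
theorem linForm (p : ℤ × ℤ) : rel (linForm α β p) (CompactFDM.linForm α' β' p) :=
  h.add (h.mul (h.intCast _) hα) (h.mul (h.intCast _) hβ)

include hα hβ hδ

theorem oddHarmonic (p : ℤ × ℤ) (m : Fin 5) :
    rel (oddHarmonic α β δ p m) (CompactFDM.oddHarmonic α' β' δ' p m) :=
  h.mul (h.add (h.linForm hα hβ p) hδ)
    (h.oddFactor (h.linForm hβ (h.neg hα) p) (h.add (h.linForm hα hβ p) hδ) m)

variable (E : OddSystem)

theorem entry (m i : Fin 5) : rel (E.entry α β δ m i) (E.entry α' β' δ' m i) :=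
  h.add (h.oddHarmonic hα hβ hδ _ m) (h.listSum _ fun x => by
    cases x.2 == i
    · exact h.zero
    · exact h.oddHarmonic hα hβ hδ _ m)

theorem rhs (m : Fin 5) : rel (E.rhs α β δ m) (E.rhs α' β' δ' m) :=
  h.add (h.neg (h.mul (h.mul (h.intCast _) (h.mul (h.linForm hα hβ _) (h.linForm hα hβ _)))
    (h.oddFactor h.zero hδ m)))
    (h.mul (h.linForm hα hβ _) (h.listSum _ fun x => h.oddHarmonic hα hβ hδ x.1 m))

theorem den : rel (E.den α β δ) (E.den α' β' δ') := h.rowDet (h.entry hα hβ hδ E)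

theorem num (i : Fin 5) : rel (E.num α β δ i) (E.num α' β' δ' i) :=
  h.rowDet fun m j => by
    cases j == i
    · exact h.entry hα hβ hδ E m j
    · exact h.rhs hα hβ hδ E m

/-- Parametricity of the certificates. With `ringRel_rep` it links the packed integers to
polynomials, with `ringRel_eval` the same polynomials to real numbers. -/
theorem certs : List.Forall₂ rel (E.certs α β δ) (E.certs α' β' δ') := by
  have h1 : ∀ x : (ℤ × ℤ) × Fin 5,
      rel (E.num α β δ x.2 + -(CompactFDM.linForm α β E.shift * E.den α β δ))
        (E.num α' β' δ' x.2 + -(CompactFDM.linForm α' β' E.shift * E.den α' β' δ')) := fun x =>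
    h.add (h.num hα hβ hδ E x.2) (h.neg (h.mul (h.linForm hα hβ _) (h.den hα hβ hδ E)))
  have hmap : ∀ {ι : Type} (l : List ι) {f : ι → R} {f' : ι → S}, (∀ i, rel (f i) (f' i)) →
      List.Forall₂ rel (l.map f) (l.map f') := by
    intro ι l f f' hf
    induction l with
    | nil => exact .nil
    | cons a l ih => exact .cons (hf a) ih
  refine List.rel_append (List.rel_append (.cons ?_ (.cons ?_ .nil)) ?_) ?_
  · exact h.den hα hβ hδ E
  · exact (h.add (h.mul (h.den hα hβ hδ E) (h.mul (h.intCast _)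
      (h.mul (h.linForm hα hβ _) (h.linForm hα hβ _))))
      (h.mul hδ (h.add (h.finSum (h.num hα hβ hδ E)) (h.listSum _ h1))))
  · exact hmap _ fun i => h.neg (h.num hα hβ hδ E i)
  · exact hmap _ fun x => h.neg (h1 x)

end RingRel

theorem ringRel_eval (u v : ℝ) : RingRel fun (p : Poly) (x : ℝ) => p.eval u v = x where
  zero := Poly.eval_zero u v
  one := Poly.eval_one u v
  intCast := Poly.eval_intCast u v
  add ha hb := by rw [Poly.eval_add, ha, hb]
  mul ha hb := by rw [Poly.eval_mul, ha, hb]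
  neg ha := by rw [Poly.eval_neg, ha]

theorem ringRel_rep (B B' : ℕ) : RingRel (Packed.Rep B B') where
  zero := ⟨rfl, le_rfl, le_rfl⟩
  one := ⟨Poly.eval_one _ _, (Poly.maj_intCast 1 1).le, (Poly.maj_intCast B 1).le⟩
  intCast n := ⟨Poly.eval_intCast _ _ n, (Poly.maj_intCast 1 n).le, (Poly.maj_intCast B n).le⟩
  add ha hb := ⟨by rw [Poly.eval_add, ha.1, hb.1]; rfl,
    (Poly.maj_add 1 _ _).trans (add_le_add ha.2.1 hb.2.1),
    (Poly.maj_add B _ _).trans (add_le_add ha.2.2 hb.2.2)⟩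
  mul ha hb := ⟨by rw [Poly.eval_mul, ha.1, hb.1]; rfl,
    (Poly.maj_mul 1 _ _).trans (Nat.mul_le_mul ha.2.1 hb.2.1),
    (Poly.maj_mul B _ _).trans (Nat.mul_le_mul ha.2.2 hb.2.2)⟩
  neg ha := ⟨by rw [Poly.eval_neg, ha.1]; rfl, (Poly.maj_neg 1 _).trans ha.2.1,
    (Poly.maj_neg B _).trans ha.2.2⟩

/-- The value of `a + b u + c v` at `u = B'`, `v = B`. -/
def Packed.lin (B B' : ℕ) (a b c : ℤ) : Packed :=
  ⟨a + b * B' + c * B, a.natAbs + b.natAbs + c.natAbs,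
    a.natAbs + b.natAbs + c.natAbs * B⟩

/-- The polynomial `a + b u + c v`. -/
def Poly.lin (a b c : ℤ) : Poly := ⟨[[a, c], [b]]⟩

theorem Poly.eval_lin {S : Type} [CommRing S] (u v : S) (a b c : ℤ) :
    (Poly.lin a b c).eval u v = a + b * u + c * v := by
  simp only [Poly.eval, Poly.lin, listEval]; ring

theorem Packed.rep_lin (B B' : ℕ) (a b c : ℤ) :
    Packed.Rep B B' (Poly.lin a b c) (Packed.lin B B' a b c) := by
  refine ⟨Poly.eval_lin _ _ a b c, le_of_eq ?_, le_of_eq ?_⟩ <;>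
    (simp only [Poly.maj, Poly.lin, Packed.lin, listEval]; ring)

/-- A vector `(α, β, δ)` with integer entries. -/
structure IntVec where
  /-- The entry `α`. -/
  a : ℤ
  /-- The entry `β`. -/
  b : ℤ
  /-- The entry `δ`. -/
  d : ℤ

namespace OddSystem

/-- The sign conditions for all `(α, β, δ)` in the cone spanned by `V₀`, `V₁`, `V₂`, without the
face spanned by `V₁` and `V₂`, in terms of one value of the polynomials. -/
def checkCone (E : OddSystem) (V₀ V₁ V₂ : IntVec) (B B' k : ℕ) : Bool :=
  (E.certs (Packed.lin B B' V₀.a V₁.a V₂.a) (Packed.lin B B' V₀.b V₁.b V₂.b)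
    (Packed.lin B B' V₀.d V₁.d V₂.d)).all (Packed.isPos B B' k)

theorem certs_pos_of_checkCone {E : OddSystem} {V₀ V₁ V₂ : IntVec} {B B' k : ℕ}
    (h : E.checkCone V₀ V₁ V₂ B B' k = true) {u v : ℝ} (hu : 0 ≤ u) (hv : 0 ≤ v) :
    ∀ x ∈ E.certs ((V₀.a : ℝ) + V₁.a * u + V₂.a * v) (V₀.b + V₁.b * u + V₂.b * v)
      (V₀.d + V₁.d * u + V₂.d * v), 0 < x := by
  have h1 := (ringRel_rep B B').certs (Packed.rep_lin B B' V₀.a V₁.a V₂.a)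
    (Packed.rep_lin B B' V₀.b V₁.b V₂.b) (Packed.rep_lin B B' V₀.d V₁.d V₂.d) E
  have h2 := (ringRel_eval u v).certs (Poly.eval_lin u v V₀.a V₁.a V₂.a)
    (Poly.eval_lin u v V₀.b V₁.b V₂.b) (Poly.eval_lin u v V₀.d V₁.d V₂.d) E
  rw [checkCone, List.all_eq_true] at h
  revert h1 h2 h
  generalize E.certs (Packed.lin B B' V₀.a V₁.a V₂.a) _ _ = l₁
  generalize E.certs (Poly.lin V₀.a V₁.a V₂.a) _ _ = l₂
  generalize E.certs ((V₀.a : ℝ) + V₁.a * u + V₂.a * v) _ _ = l₃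
  intro h h1 h2
  induction h1 generalizing l₃ with
  | nil => cases h2; simp
  | cons hax _ ih =>
    cases h2 with
    | cons hab h2 =>
      intro x hx
      rcases List.mem_cons.1 hx with rfl | hx
      · rw [← hab]
        exact hax.eval_pos (h _ List.mem_cons_self) hu hv
      · exact ih _ (fun y hy => h y (List.mem_cons_of_mem _ hy)) h2 x hx

end OddSystem

/-! ### The six types of boundary stencils -/

/-- The equations for the six types of stencils. For the third type, `l` tells whether
`α + β ≤ 0`. -/
def StencilType.oddSystem (l : Bool) : StencilType → OddSystem
  | .one => ⟨![(1, 1), (-1, 1), (-1, 2), (0, 2), (1, 2)], [((-1, 0), 0)], 4, (0, 1), (0, 1)⟩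
  | .two => ⟨![(1, 1), (-1, 1), (-1, 2), (0, 2), (1, 2)], [((-1, 0), 0), ((1, 0), 1)],
      5, (0, 1), (0, 1)⟩
  | .three => ⟨![(-1, 1), (-1, 0), (-2, 1), (-1, 2), (0, 1)], [((-1, -1), 0), ((1, 1), 0)],
      15, (-1, 1), bif l then (-2, 0) else (0, 2)⟩
  | .four => ⟨![(0, -1), (1, 0), (-1, 0), (-1, 1), (0, 1)], [((1, 1), 0), ((-1, -1), 1)],
      1, (-1, 1), (0, 0)⟩
  | .five => ⟨![(-1, 1), (-1, 2), (0, 2), (1, 2), (1, 1)], [], 1, (0, 1), (0, 0)⟩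
  | .six => ⟨![(-1, 0), (-2, 1), (-1, 1), (-1, 2), (0, 1)], [], 1, (-1, 1), (0, 0)⟩

/-- The certificates have total degree at most 17, so 20 digits suffice in either base, and 20
digits to the base `2 ^ 256` fit below `2 ^ 8192`. The cones are slightly larger than those of the
ideal configurations; the odd numbers in their generators come from this enlargement. -/
theorem checkCone_one : (StencilType.one.oddSystem true).checkCone
    ⟨1, 50, 0⟩ ⟨-26, 25, 0⟩ ⟨-51, 100, 53⟩ (2 ^ 256) (2 ^ 8192) 20 = true := by
  decide +kernel

theorem checkCone_two_left : (StencilType.two.oddSystem true).checkCone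
    ⟨0, 1, 0⟩ ⟨0, 25, 26⟩ ⟨-26, 25, 26⟩ (2 ^ 256) (2 ^ 8192) 20 = true := by
  decide +kernel

theorem checkCone_two_right : (StencilType.two.oddSystem true).checkCone
    ⟨0, 1, 0⟩ ⟨0, 25, 26⟩ ⟨26, 25, 26⟩ (2 ^ 256) (2 ^ 8192) 20 = true := by
  decide +kernel

theorem checkCone_three_left : (StencilType.three.oddSystem true).checkCone
    ⟨-1, 1, 0⟩ ⟨-50, 50, 53⟩ ⟨-203, 97, 106⟩ (2 ^ 256) (2 ^ 8192) 20 = true := by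
  decide +kernel

theorem checkCone_three_right : (StencilType.three.oddSystem false).checkCone
    ⟨-1, 1, 0⟩ ⟨-50, 50, 53⟩ ⟨-97, 203, 106⟩ (2 ^ 256) (2 ^ 8192) 20 = true := by
  decide +kernel

theorem checkCone_four_left : (StencilType.four.oddSystem true).checkCone
    ⟨-1, 1, 1⟩ ⟨-25, 25, 52⟩ ⟨-26, -1, 26⟩ (2 ^ 256) (2 ^ 8192) 20 = true := by
  decide +kernel

theorem checkCone_four_right : (StencilType.four.oddSystem true).checkCone
    ⟨-1, 1, 1⟩ ⟨-25, 25, 52⟩ ⟨1, 26, 26⟩ (2 ^ 256) (2 ^ 8192) 20 = true := by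
  decide +kernel

theorem checkCone_five : (StencilType.five.oddSystem true).checkCone
    ⟨0, 25, 1⟩ ⟨-1, 25, 0⟩ ⟨1, 25, 0⟩ (2 ^ 256) (2 ^ 8192) 20 = true := by
  decide +kernel

theorem checkCone_six : (StencilType.six.oddSystem true).checkCone
    ⟨-25, 25, 2⟩ ⟨-13, 12, 0⟩ ⟨-12, 13, 0⟩ (2 ^ 256) (2 ^ 8192) 20 = true := by
  decide +kernel

/-! ### Signs of the zeroth-order boundary coefficients -/

theorem oddHarmonic_smul (k α β δ : ℝ) (p : ℤ × ℤ) (m : Fin 5) :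
    oddHarmonic (k * α) (k * β) (k * δ) p m = k ^ (5 - m.val) * oddHarmonic α β δ p m := by
  fin_cases m <;> simp [oddHarmonic, oddFactor, linForm] <;> ring

theorem linForm_smul (k α β : ℝ) (p : ℤ × ℤ) : linForm (k * α) (k * β) p = k * linForm α β p := by
  simp only [linForm]; ring

theorem oddHarmonic_zero (α β δ : ℝ) (m : Fin 5) :
    oddHarmonic α β δ (0, 0) m = δ * oddFactor 0 δ m := by
  simp [oddHarmonic, linForm]

/-- The vector `(α, β, δ)` lies in a cone for which the sign conditions have been checked. -/
def OddSystem.Admissible (E : OddSystem) (α β δ : ℝ) : Prop :=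
  ∃ V₀ V₁ V₂ : IntVec, E.checkCone V₀ V₁ V₂ (2 ^ 256) (2 ^ 8192) 20 = true ∧
    ∃ a b c : ℝ, 0 < a ∧ 0 ≤ b ∧ 0 ≤ c ∧ α = a * V₀.a + b * V₁.a + c * V₂.a ∧
      β = a * V₀.b + b * V₁.b + c * V₂.b ∧ δ = a * V₀.d + b * V₁.d + c * V₂.d

/-- The equations are homogeneous in `(α, β, δ)` and the extra terms `σ δ / ρ ^ 2` are invariant
under scaling, so the coefficient of `V₀` can be normalized to 1. -/
theorem OddSystem.Admissible.signs {E : OddSystem} {α β δ : ℝ} (h : E.Admissible α β δ)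
    (c : ℤ × ℤ → ℝ) (hδ : 0 < δ) (hρ : 0 < linForm α β E.root) (hL : 0 < E.scale)
    (hsys : ∀ m, oddHarmonic α β δ (0, 0) m +
      ∑ i, c (E.unknown i) * oddHarmonic α β δ (E.unknown i) m +
      (E.merged.map fun x => c x.1 * oddHarmonic α β δ x.1 m).sum = 0)
    (hmer : ∀ x ∈ E.merged, c x.1 = c (E.unknown x.2) -
      linForm α β E.shift * δ / (E.scale * linForm α β E.root ^ 2)) :
    (∀ i, c (E.unknown i) < 0) ∧ (∀ x ∈ E.merged, c x.1 < 0) ∧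
      0 < 1 + ∑ i, c (E.unknown i) + (E.merged.map fun x => c x.1).sum := by
  obtain ⟨V₀, V₁, V₂, hcheck, k, b, d, hk, hb, hd, hα, hβ, hδ'⟩ := h
  have hcert := certs_pos_of_checkCone hcheck (div_nonneg hb hk.le) (div_nonneg hd hk.le)
  have e : ∀ x y z : ℝ, x + y * (b / k) + z * (d / k) = k⁻¹ * (k * x + b * y + d * z) := by
    intro x y z; field_simp
  rw [e, e, e, ← hα, ← hβ, ← hδ'] at hcert
  have hk' : 0 < k⁻¹ := inv_pos.2 hk
  refine E.signs_of_certs _ _ _ c (mul_pos hk' hδ) ?_ hL (fun m => ?_) (fun x hx => ?_) hcert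
  · rw [linForm_smul]; exact mul_pos hk' hρ
  · have h1 := congrArg (k⁻¹ ^ (5 - m.val) * ·) (hsys m)
    simp only [mul_add, mul_zero, Finset.mul_sum, ← List.sum_map_mul_left,
      mul_left_comm _ (c _), ← oddHarmonic_smul] at h1
    rw [oddHarmonic_zero] at h1
    linarith only [h1]
  · rw [hmer x hx, linForm_smul, linForm_smul]
    generalize linForm α β E.shift = σ
    generalize linForm α β E.root = ρ
    rw [show k⁻¹ * σ * (k⁻¹ * δ) = k⁻¹ ^ 2 * (σ * δ) by ring,
      show (E.scale : ℝ) * (k⁻¹ * ρ) ^ 2 = k⁻¹ ^ 2 * (E.scale * ρ ^ 2) by ring,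
      mul_div_mul_left _ _ (pow_pos hk' 2).ne']

theorem StencilType.sum_stencil (T : StencilType) (l : Bool) (f : ℤ × ℤ → ℝ) :
    ∑ p ∈ T.stencil, f p = f (0, 0) + ∑ i, f ((T.oddSystem l).unknown i) +
      ((T.oddSystem l).merged.map fun x => f x.1).sum := by
  cases T <;> simp [StencilType.stencil, StencilType.oddSystem, Fin.sum_univ_succ] <;> ring

theorem StencilType.mem_stencil (T : StencilType) (l : Bool) {p : ℤ × ℤ} (hp : p ∈ T.stencil) :
    p = (0, 0) ∨ (∃ i, p = (T.oddSystem l).unknown i) ∨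
      ∃ x ∈ (T.oddSystem l).merged, p = x.1 := by
  cases T <;> revert p <;> cases l <;> decide

theorem StencilType.signs {T : StencilType} {l : Bool} {α β δ : ℝ}
    (h : (T.oddSystem l).Admissible α β δ) (c : ℤ × ℤ → ℝ) (hδ : 0 < δ)
    (hρ : 0 < linForm α β (T.oddSystem l).root) (hc : c (0, 0) = 1)
    (hsys : ∀ m, ∑ p ∈ T.stencil, c p * oddHarmonic α β δ p m = 0)
    (hmer : ∀ x ∈ (T.oddSystem l).merged, c x.1 = c ((T.oddSystem l).unknown x.2) -
      linForm α β (T.oddSystem l).shift * δ /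
        ((T.oddSystem l).scale * linForm α β (T.oddSystem l).root ^ 2)) :
    (∀ p ∈ T.stencil, p ≠ (0, 0) → c p < 0) ∧ 0 < ∑ p ∈ T.stencil, c p := by
  have hs := h.signs c hδ hρ (by cases T <;> simp [StencilType.oddSystem])
    (fun m => by
      have := hsys m
      rw [T.sum_stencil l, hc, one_mul] at this
      exact this) hmer
  refine ⟨fun p hp hp0 => ?_, ?_⟩
  · rcases T.mem_stencil l hp with rfl | ⟨i, rfl⟩ | ⟨x, hx, rfl⟩
    · exact absurd rfl hp0
    · exact hs.1 i
    · exact hs.2.1 x hx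
  · rw [T.sum_stencil l, hc]
    exact hs.2.2

/-! ### The position of the tangent line in the eight cases -/

/-- The lower bound `1/2` turns additive errors such as `1/100` into multiples of `y`, that is, into
the homogeneous inequalities that describe a cone. -/
theorem half_le_of_abs_le {x y : ℝ} (h : 1 ≤ x ^ 2 + y ^ 2) (hx : |x| ≤ y + 1 / 10) :
    1 / 2 ≤ y := by
  by_contra hy
  push Not at hy
  have hy' := (abs_nonneg x).trans hx
  have h1 : x ^ 2 ≤ (6 / 10) ^ 2 :=
    sq_le_sq' (by linarith [neg_abs_le x]) (by linarith [le_abs_self x])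
  have h2 : y ^ 2 ≤ (1 / 2) ^ 2 := sq_le_sq' (by linarith) hy.le
  norm_num at h1 h2
  linarith

/-- The line `α x + β y + δ = 0` is positioned according to the case, up to an error of `1/100`:
the available points of the reference stencil lie on its left, and the other ones on its right. -/
def BdryCase.Fits (K : BdryCase) (α β δ : ℝ) : Prop :=
  ∀ p ∈ refStencil, (p ∉ K.missing → 0 < linForm α β p + δ) ∧
    (p ∈ K.missing → linForm α β p + δ ≤ 1 / 100)

/-- Consequences of the position of the line `α x + β y + δ = 0` for a stencil type. -/
structure StencilType.Good (T : StencilType) (l : Bool) (α β δ : ℝ) : Prop where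
  admissible : (T.oddSystem l).Admissible α β δ
  root : 1 / 2 ≤ linForm α β (T.oddSystem l).root
  side : T = .three → |α + β| = bif l then -(α + β) else α + β
  far : ∀ p ∈ T.stencil, p ∉ refStencil → 1 / 10 < linForm α β p + δ

theorem linForm_add_le {α β δ : ℝ} {K : BdryCase} (h : K.Fits α β δ) (p : ℤ × ℤ)
    (hp : p ∈ refStencil) (hK : p ∈ K.missing) : p.1 * α + p.2 * β + δ ≤ 1 / 100 :=
  (h p hp).2 hK

theorem linForm_add_pos {α β δ : ℝ} {K : BdryCase} (h : K.Fits α β δ) (p : ℤ × ℤ)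
    (hp : p ∈ refStencil) (hK : p ∉ K.missing) : 0 < p.1 * α + p.2 * β + δ :=
  (h p hp).1 hK

theorem BdryCase.good_I {α β δ : ℝ} (h : α ^ 2 + β ^ 2 = 1) (hK : BdryCase.I.Fits α β δ) :
    ∃ l, StencilType.one.Good l α β δ := by
  have p0 := linForm_add_pos hK (0, 0) (by decide) (by decide)
  have p1 := linForm_add_pos hK (-1, 0) (by decide) (by decide)
  have p2 := linForm_add_pos hK (1, 1) (by decide) (by decide)
  have p3 := linForm_add_pos hK (-1, 1) (by decide) (by decide)
  have p4 := linForm_add_pos hK (0, 1) (by decide) (by decide)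
  have n0 := linForm_add_le hK (-1, -1) (by decide) (by decide)
  have n1 := linForm_add_le hK (1, 0) (by decide) (by decide)
  norm_num at p0 p1 p2 p3 p4 n0 n1
  have hβ := half_le_of_abs_le h.ge (by rw [abs_le]; constructor <;> linarith)
  -- Barycentric coordinates in the cone. They have the right signs because `δ - α - β ≤ 1/100` and
  -- `α + δ ≤ 1/100`, while `β ≥ 1/2` exceeds `25/100` and is at least `50/100`.
  refine ⟨true, ⟨_, _, _, checkCone_one, (25 * α + 26 * β - 25 * δ) / 1325,
      (β - 50 * α - 50 * δ) / 1325, δ / 53, ?_, ?_, ?_, ?_, ?_, ?_⟩, ?_, ?_, ?_⟩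
  · linarith
  · linarith
  · linarith
  · push_cast; ring
  · push_cast; ring
  · push_cast; ring
  · norm_num [StencilType.oddSystem, linForm]; linarith
  · intro h; cases h
  · intro p hp hp2
    fin_cases hp <;> first | exact absurd (by decide) hp2 | (norm_num [linForm]; linarith)

/-- From `δ ≤ β + 1/100` and `β ≥ 1/2` it follows that `25 δ < 26 β`. The resulting cone `|α| ≤ δ ≤
26 β / 25` is cut along its plane of symmetry `α = 0`. -/
theorem StencilType.good_two {α β δ : ℝ} (p0 : 0 < δ) (h1 : 0 < δ - α) (h2 : 0 < δ + α)
    (h3 : δ - β ≤ 1 / 100) (hβ : 1 / 2 ≤ β) : ∃ l, StencilType.two.Good l α β δ := by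
  rcases le_total α 0 with h0 | h0
  · refine ⟨true, ⟨_, _, _, checkCone_two_left, β - 25 * δ / 26,
        (δ + α) / 26, -α / 26, ?_, ?_, ?_, ?_, ?_, ?_⟩, ?_, ?_, ?_⟩
    · linarith
    · linarith
    · linarith
    · push_cast; ring
    · push_cast; ring
    · push_cast; ring
    · norm_num [StencilType.oddSystem, linForm]; linarith
    · intro h; cases h
    · intro p hp hp2
      fin_cases hp <;> first | exact absurd (by decide) hp2 | (norm_num [linForm]; linarith)
  · refine ⟨true, ⟨_, _, _, checkCone_two_right, β - 25 * δ / 26,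
        (δ - α) / 26, α / 26, ?_, ?_, ?_, ?_, ?_, ?_⟩, ?_, ?_, ?_⟩
    · linarith
    · linarith
    · linarith
    · push_cast; ring
    · push_cast; ring
    · push_cast; ring
    · norm_num [StencilType.oddSystem, linForm]; linarith
    · intro h; cases h
    · intro p hp hp2
      fin_cases hp <;> first | exact absurd (by decide) hp2 | (norm_num [linForm]; linarith)

theorem BdryCase.good_II {α β δ : ℝ} (h : α ^ 2 + β ^ 2 = 1) (hK : BdryCase.II.Fits α β δ) :
    ∃ l, StencilType.two.Good l α β δ := by
  have p0 := linForm_add_pos hK (0, 0) (by decide) (by decide)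
  have p1 := linForm_add_pos hK (-1, 0) (by decide) (by decide)
  have p2 := linForm_add_pos hK (1, 0) (by decide) (by decide)
  have p3 := linForm_add_pos hK (1, 1) (by decide) (by decide)
  have p4 := linForm_add_pos hK (-1, 1) (by decide) (by decide)
  have p5 := linForm_add_pos hK (0, 1) (by decide) (by decide)
  have n0 := linForm_add_le hK (-1, -1) (by decide) (by decide)
  have n1 := linForm_add_le hK (0, -1) (by decide) (by decide)
  have n2 := linForm_add_le hK (1, -1) (by decide) (by decide)
  norm_num at p0 p1 p2 p3 p4 p5 n0 n1 n2
  have hβ := half_le_of_abs_le h.ge (by rw [abs_le]; constructor <;> linarith)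
  exact StencilType.good_two p0 (by linarith) (by linarith) (by linarith) hβ

theorem BdryCase.good_IV {α β δ : ℝ} (h : α ^ 2 + β ^ 2 = 1) (hK : BdryCase.IV.Fits α β δ) :
    ∃ l, StencilType.two.Good l α β δ := by
  have p0 := linForm_add_pos hK (0, 0) (by decide) (by decide)
  have p1 := linForm_add_pos hK (-1, 0) (by decide) (by decide)
  have p2 := linForm_add_pos hK (1, 0) (by decide) (by decide)
  have p3 := linForm_add_pos hK (-1, -1) (by decide) (by decide)
  have p4 := linForm_add_pos hK (1, 1) (by decide) (by decide)
  have p5 := linForm_add_pos hK (-1, 1) (by decide) (by decide)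
  have p6 := linForm_add_pos hK (0, 1) (by decide) (by decide)
  have n0 := linForm_add_le hK (0, -1) (by decide) (by decide)
  have n1 := linForm_add_le hK (1, -1) (by decide) (by decide)
  norm_num at p0 p1 p2 p3 p4 p5 p6 n0 n1
  have hβ := half_le_of_abs_le h.ge (by rw [abs_le]; constructor <;> linarith)
  exact StencilType.good_two p0 (by linarith) (by linarith) (by linarith) hβ

theorem BdryCase.good_VIII {α β δ : ℝ} (h : α ^ 2 + β ^ 2 = 1) (hK : BdryCase.VIII.Fits α β δ) :
    ∃ l, StencilType.two.Good l α β δ := by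
  have p0 := linForm_add_pos hK (0, 0) (by decide) (by decide)
  have p1 := linForm_add_pos hK (0, -1) (by decide) (by decide)
  have p2 := linForm_add_pos hK (-1, 0) (by decide) (by decide)
  have p3 := linForm_add_pos hK (1, 0) (by decide) (by decide)
  have p4 := linForm_add_pos hK (1, 1) (by decide) (by decide)
  have p5 := linForm_add_pos hK (-1, 1) (by decide) (by decide)
  have p6 := linForm_add_pos hK (0, 1) (by decide) (by decide)
  have n0 := linForm_add_le hK (-1, -1) (by decide) (by decide)
  have n1 := linForm_add_le hK (1, -1) (by decide) (by decide)
  norm_num at p0 p1 p2 p3 p4 p5 p6 n0 n1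
  have hβ := half_le_of_abs_le h.ge (by rw [abs_le]; constructor <;> linarith)
  exact StencilType.good_two p0 (by linarith) (by linarith) (by linarith) hβ

theorem BdryCase.good_III {α β δ : ℝ} (h : α ^ 2 + β ^ 2 = 1) (hK : BdryCase.III.Fits α β δ) :
    ∃ l, StencilType.three.Good l α β δ := by
  have p0 := linForm_add_pos hK (0, 0) (by decide) (by decide)
  have p1 := linForm_add_pos hK (-1, -1) (by decide) (by decide)
  have p2 := linForm_add_pos hK (1, 1) (by decide) (by decide)
  have p3 := linForm_add_pos hK (-1, 1) (by decide) (by decide)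
  have p4 := linForm_add_pos hK (-1, 0) (by decide) (by decide)
  have p5 := linForm_add_pos hK (0, 1) (by decide) (by decide)
  have n0 := linForm_add_le hK (0, -1) (by decide) (by decide)
  have n1 := linForm_add_le hK (1, -1) (by decide) (by decide)
  have n2 := linForm_add_le hK (1, 0) (by decide) (by decide)
  norm_num at p0 p1 p2 p3 p4 p5 n0 n1 n2
  have hβ := half_le_of_abs_le (x := α + β) (y := β - α) (by nlinarith)
    (by rw [abs_le]; constructor <;> linarith)
  -- The extra equations contain `|α + β|`; they are polynomial only on each side of the diagonal,
  -- where the flag `l` selects the sign.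
  rcases le_total (α + β) 0 with h0 | h0
  · refine ⟨true, ⟨_, _, _, checkCone_three_left,
        (β - α - 100 * ((δ + α + β) / 53) + 300 * ((α + β) / 106)) / 2,
        (δ + α + β) / 53, -(α + β) / 106, ?_, ?_, ?_, ?_, ?_, ?_⟩, ?_, ?_, ?_⟩
    · linarith
    · linarith
    · linarith
    · push_cast; ring
    · push_cast; ring
    · push_cast; ring
    · norm_num [StencilType.oddSystem, linForm]; linarith
    · intro _; exact abs_of_nonpos h0
    · intro p hp hp2
      fin_cases hp <;> first | exact absurd (by decide) hp2 | (norm_num [linForm]; linarith)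
  · refine ⟨false, ⟨_, _, _, checkCone_three_right,
        (β - α - 100 * ((δ - α - β) / 53) - 300 * ((α + β) / 106)) / 2,
        (δ - α - β) / 53, (α + β) / 106, ?_, ?_, ?_, ?_, ?_, ?_⟩, ?_, ?_, ?_⟩
    · linarith
    · linarith
    · linarith
    · push_cast; ring
    · push_cast; ring
    · push_cast; ring
    · norm_num [StencilType.oddSystem, linForm]; linarith
    · intro _; exact abs_of_nonneg h0
    · intro p hp hp2
      fin_cases hp <;> first | exact absurd (by decide) hp2 | (norm_num [linForm]; linarith)

theorem BdryCase.good_V {α β δ : ℝ} (h : α ^ 2 + β ^ 2 = 1) (hK : BdryCase.V.Fits α β δ) :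
    ∃ l, StencilType.four.Good l α β δ := by
  have p0 := linForm_add_pos hK (0, 0) (by decide) (by decide)
  have p1 := linForm_add_pos hK (-1, -1) (by decide) (by decide)
  have p2 := linForm_add_pos hK (1, 1) (by decide) (by decide)
  have p3 := linForm_add_pos hK (-1, 1) (by decide) (by decide)
  have p4 := linForm_add_pos hK (-1, 0) (by decide) (by decide)
  have p5 := linForm_add_pos hK (0, 1) (by decide) (by decide)
  have p6 := linForm_add_pos hK (1, 0) (by decide) (by decide)
  have p7 := linForm_add_pos hK (0, -1) (by decide) (by decide)
  have n0 := linForm_add_le hK (1, -1) (by decide) (by decide)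
  norm_num at p0 p1 p2 p3 p4 p5 p6 p7 n0
  have hβ := half_le_of_abs_le (x := α + β) (y := β - α) (by nlinarith)
    (by rw [abs_le]; constructor <;> linarith)
  rcases le_total (α + β) 0 with h0 | h0
  · refine ⟨true, ⟨_, _, _, checkCone_four_left,
        δ - 52 * ((2 * δ - β + α - 27 * (-(α + β) / 27)) / 54) - 26 * (-(α + β) / 27),
        ((2 * δ - β + α - 27 * (-(α + β) / 27)) / 54), (-(α + β) / 27),
        ?_, ?_, ?_, ?_, ?_, ?_⟩, ?_, ?_, ?_⟩
    · linarith
    · linarith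
    · linarith
    · push_cast; ring
    · push_cast; ring
    · push_cast; ring
    · norm_num [StencilType.oddSystem, linForm]; linarith
    · intro h; cases h
    · intro p hp hp2
      fin_cases hp <;> exact absurd (by decide) hp2
  · refine ⟨true, ⟨_, _, _, checkCone_four_right,
        δ - 52 * ((2 * δ - β + α - 27 * ((α + β) / 27)) / 54) - 26 * ((α + β) / 27),
        ((2 * δ - β + α - 27 * ((α + β) / 27)) / 54), ((α + β) / 27),
        ?_, ?_, ?_, ?_, ?_, ?_⟩, ?_, ?_, ?_⟩
    · linarith
    · linarith
    · linarith
    · push_cast; ring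
    · push_cast; ring
    · push_cast; ring
    · norm_num [StencilType.oddSystem, linForm]; linarith
    · intro h; cases h
    · intro p hp hp2
      fin_cases hp <;> exact absurd (by decide) hp2

theorem BdryCase.good_VI {α β δ : ℝ} (h : α ^ 2 + β ^ 2 = 1) (hK : BdryCase.VI.Fits α β δ) :
    ∃ l, StencilType.five.Good l α β δ := by
  have p0 := linForm_add_pos hK (0, 0) (by decide) (by decide)
  have p1 := linForm_add_pos hK (1, 1) (by decide) (by decide)
  have p2 := linForm_add_pos hK (-1, 1) (by decide) (by decide)
  have p3 := linForm_add_pos hK (0, 1) (by decide) (by decide)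
  have n0 := linForm_add_le hK (-1, 0) (by decide) (by decide)
  have n1 := linForm_add_le hK (1, 0) (by decide) (by decide)
  have n2 := linForm_add_le hK (-1, -1) (by decide) (by decide)
  have n3 := linForm_add_le hK (1, -1) (by decide) (by decide)
  norm_num at p0 p1 p2 p3 n0 n1 n2 n3
  have hβ := half_le_of_abs_le h.ge (by rw [abs_le]; constructor <;> linarith)
  refine ⟨true, ⟨_, _, _, checkCone_five, δ,
      (β / 25 - δ - α) / 2, (β / 25 - δ + α) / 2, ?_, ?_, ?_, ?_, ?_, ?_⟩, ?_, ?_, ?_⟩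
  · linarith
  · linarith
  · linarith
  · push_cast; ring
  · push_cast; ring
  · push_cast; ring
  · norm_num [StencilType.oddSystem, linForm]; linarith
  · intro h; cases h
  · intro p hp hp2
    fin_cases hp <;> first | exact absurd (by decide) hp2 | (norm_num [linForm]; linarith)

theorem BdryCase.good_VII {α β δ : ℝ} (h : α ^ 2 + β ^ 2 = 1) (hK : BdryCase.VII.Fits α β δ) :
    ∃ l, StencilType.six.Good l α β δ := by
  have p0 := linForm_add_pos hK (0, 0) (by decide) (by decide)
  have p1 := linForm_add_pos hK (-1, 1) (by decide) (by decide)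
  have p2 := linForm_add_pos hK (-1, 0) (by decide) (by decide)
  have p3 := linForm_add_pos hK (0, 1) (by decide) (by decide)
  have n0 := linForm_add_le hK (-1, -1) (by decide) (by decide)
  have n1 := linForm_add_le hK (1, 1) (by decide) (by decide)
  have n2 := linForm_add_le hK (0, -1) (by decide) (by decide)
  have n3 := linForm_add_le hK (1, 0) (by decide) (by decide)
  norm_num at p0 p1 p2 p3 n0 n1 n2 n3
  have hβ := half_le_of_abs_le (x := α + β) (y := β - α) (by nlinarith)
    (by rw [abs_le]; constructor <;> linarith)
  refine ⟨true, ⟨_, _, _, checkCone_six, δ / 2,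
      ((β - α - 25 * δ) / 25 - (α + β)) / 2, ((β - α - 25 * δ) / 25 + (α + β)) / 2,
      ?_, ?_, ?_, ?_, ?_, ?_⟩, ?_, ?_, ?_⟩
  · linarith
  · linarith
  · linarith
  · push_cast; ring
  · push_cast; ring
  · push_cast; ring
  · norm_num [StencilType.oddSystem, linForm]; linarith
  · intro h; cases h
  · intro p hp hp2
    fin_cases hp <;> first | exact absurd (by decide) hp2 | (norm_num [linForm]; linarith)

theorem BdryCase.good (K : BdryCase) {α β δ : ℝ} (h : α ^ 2 + β ^ 2 = 1) (hK : K.Fits α β δ) :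
    ∃ l, K.type.Good l α β δ := by
  cases K
  exacts [good_I h hK, good_II h hK, good_III h hK, good_IV h hK, good_V h hK, good_VI h hK,
    good_VII h hK, good_VIII h hK]

/-! ### The boundary equations in standard position -/

theorem bigATilde_self (D : ℕ → ℕ → ℂ) (m : ℕ) : bigATilde D m 0 m 0 = 1 := by
  rw [bigATilde]; simp

theorem coefA_self (D : ℕ → ℕ → ℂ) (m : ℕ) (p : ℂ) : coefA D m m p = p ^ m / m.factorial := by
  simp [coefA, bigATilde_self, taylorN]

/-- At leading order the sum with the curve coefficients is empty and `Ã` is 1, so neither `a` nor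
the curvature survives. -/
theorem coefABoundary_self (D : ℕ → ℕ → ℂ) (z : ℕ → ℂ) (θ : ℝ) (m : ℕ) (p : ℂ) :
    coefABoundary D z θ m m p =
      -2 / m.factorial * ((p * Complex.exp (-(θ * Complex.I))) ^ m).im := by
  have h1 : p ^ m / m.factorial * Complex.exp (-(m * θ * Complex.I)) =
      ((1 / m.factorial : ℝ) : ℂ) * (p * Complex.exp (-(θ * Complex.I))) ^ m := by
    rw [mul_pow, ← Complex.exp_nat_mul,
      show (m : ℂ) * -(θ * Complex.I) = -(m * θ * Complex.I) by ring]
    push_cast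
    ring
  rw [coefABoundary, Finset.Icc_eq_empty (by omega), Finset.sum_empty, add_zero, coefA_self, h1,
    Complex.im_ofReal_mul]
  ring

theorem toC_sym (k : Fin 4) (f : Bool) (p : ℤ × ℤ) : toC (sym k f p) = symC k f (toC p) := by
  have hI : Complex.I ^ 3 = -Complex.I := by rw [pow_succ, Complex.I_sq]; ring
  fin_cases k <;> cases f <;> apply Complex.ext <;> simp [toC, sym, symC, hI]

theorem symC_toC (k : Fin 4) (f : Bool) (p : ℤ × ℤ) :
    symC k f (toC p) = p.1 * symC k f 1 + p.2 * symC k f Complex.I := by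
  cases f <;> simp [toC, symC] <;> ring

theorem sym_zero (k : Fin 4) (f : Bool) : sym k f (0, 0) = (0, 0) := by
  fin_cases k <;> simp [sym]

theorem sym_injective (k : Fin 4) (f : Bool) : Function.Injective (sym k f) := by
  intro p q h
  fin_cases k <;> cases f <;> simp_all [sym, Prod.ext_iff]

theorem norm_symC (k : Fin 4) (f : Bool) (w : ℂ) : ‖symC k f w‖ = ‖w‖ := by
  cases f <;> simp [symC]

/-- By the binomial theorem, a real translation of `w` does not change the span of the `Im (w ^ m)`,
`1 ≤ m ≤ 5`; a reflection of the real part only changes signs. The equations therefore depend on the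
line, not on the position of the base point on it. -/
theorem sum_mul_oddHarmonic_eq_zero {ι : Type*} (A : Finset ι) (c X Y : ι → ℝ) (w : ι → ℂ)
    (x e : ℝ) (he : e ^ 2 = 1) (hre : ∀ p, (w p).re = x + e * X p) (him : ∀ p, (w p).im = Y p)
    (h : ∀ m : ℕ, 1 ≤ m → m ≤ 5 → ∑ p ∈ A, c p * ((w p) ^ m).im = 0) (m : Fin 5) :
    ∑ p ∈ A, c p * (Y p * oddFactor (X p) (Y p) m) = 0 := by
  have hX : ∀ p, X p = e * ((w p).re - x) := fun p => by
    rw [hre]; linear_combination -X p * he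
  have e4 : e ^ 4 = 1 := by rw [show e ^ 4 = (e ^ 2) ^ 2 by ring, he, one_pow]
  have e3 : e ^ 3 = e := by rw [show e ^ 3 = e ^ 2 * e by ring, he, one_mul]
  have key : ∃ a : Fin 5 → ℝ, ∀ p, Y p * oddFactor (X p) (Y p) m =
      ∑ k : Fin 5, a k * ((w p) ^ (k.val + 1)).im := by
    fin_cases m
    · refine ⟨![5 * x ^ 4, -10 * x ^ 3, 10 * x ^ 2, -5 * x, 1], fun p => ?_⟩
      rw [hX, ← him]
      simp [oddFactor, Fin.sum_univ_succ, pow_succ]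
      ring_nf
      simp only [he, e4]
      ring
    · refine ⟨![-e * x ^ 3, e * (3 / 2) * x ^ 2, -e * x, e / 4, 0], fun p => ?_⟩
      rw [hX, ← him]
      simp [oddFactor, Fin.sum_univ_succ, pow_succ]
      ring_nf
      simp only [e3]
    · refine ⟨![3 * x ^ 2, -3 * x, 1, 0, 0], fun p => ?_⟩
      rw [hX, ← him]
      simp [oddFactor, Fin.sum_univ_succ, pow_succ]
      ring_nf
      simp only [he]
      ring
    · refine ⟨![-e * x, e / 2, 0, 0, 0], fun p => ?_⟩
      rw [hX, ← him]
      simp [oddFactor, Fin.sum_univ_succ, pow_succ]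
      ring
    · refine ⟨![1, 0, 0, 0, 0], fun p => ?_⟩
      rw [hX, ← him]
      simp [oddFactor, Fin.sum_univ_succ]
  obtain ⟨a, ha⟩ := key
  simp only [ha, Finset.mul_sum]
  rw [Finset.sum_comm]
  refine Finset.sum_eq_zero fun k _ => ?_
  simp only [mul_left_comm (c _), ← Finset.mul_sum]
  rw [h _ (by omega) (by omega), mul_zero]

/-! ### The tangent line in stencil coordinates -/

namespace BoundarySetup
variable {Ω : Set ℂ} {h : ℝ} {s : ℂ} (B : BoundarySetup Ω h s)

/-- The rotation by minus the tangent angle. -/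
noncomputable def rot : ℂ := Complex.exp (-(tangentAngle B.γ B.t * Complex.I))

/-- The coefficient `α` of the equation `α x + β y + δ = 0` of the tangent line in standard
position. -/
noncomputable def α : ℝ := (symC B.k B.f 1 * B.rot).im

/-- The coefficient `β` of the equation `α x + β y + δ = 0` of the tangent line in standard
position. -/
noncomputable def β : ℝ := (symC B.k B.f Complex.I * B.rot).im

/-- The coefficient `δ` of the equation `α x + β y + δ = 0` of the tangent line in standard
position. -/
noncomputable def δ : ℝ := ((s - B.b) / h * B.rot).im

theorem rot_mul_exp : B.rot * Complex.exp (tangentAngle B.γ B.t * Complex.I) = 1 := by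
  rw [rot, ← Complex.exp_add, neg_add_cancel, Complex.exp_zero]

theorem norm_rot : ‖B.rot‖ = 1 := by
  rw [rot, ← neg_mul, ← Complex.ofReal_neg, Complex.norm_exp_ofReal_mul_I]

theorem rot_sq : B.rot.re ^ 2 + B.rot.im ^ 2 = 1 := by
  have h1 := Complex.sq_norm B.rot
  rw [B.norm_rot, Complex.normSq_apply] at h1
  linarith

theorem exists_rot : ∃ a b : ℝ, a ^ 2 + b ^ 2 = 1 ∧ Complex.I ^ (B.k : ℕ) * B.rot = ⟨a, b⟩ := by
  have h1 : ‖Complex.I ^ (B.k : ℕ) * B.rot‖ = 1 := by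
    rw [norm_mul, norm_pow, Complex.norm_I, one_pow, B.norm_rot, one_mul]
  generalize Complex.I ^ (B.k : ℕ) * B.rot = w at h1
  have h2 := Complex.sq_norm w
  rw [h1, Complex.normSq_apply] at h2
  exact ⟨w.re, w.im, by linarith, rfl⟩

theorem α_sq_add_β_sq : B.α ^ 2 + B.β ^ 2 = 1 := by
  obtain ⟨a, b, hab, hr⟩ := B.exists_rot
  have h1 : ∀ w : ℂ, symC B.k B.f w * B.rot =
      (if B.f then starRingEnd ℂ w else w) * ⟨a, b⟩ := fun w => by rw [← hr, symC]; ring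
  rw [α, β, h1, h1]
  cases B.f <;> simp <;> linarith

/-- The offset of a stencil point from the base point, with the tangent line rotated to the real
line. -/
noncomputable def offset (p : ℤ × ℤ) : ℂ := (toC (sym B.k B.f p) + (s - B.b) / h) * B.rot

theorem offset_im (p : ℤ × ℤ) : (B.offset p).im = linForm B.α B.β p + B.δ := by
  rw [offset, add_mul, Complex.add_im, toC_sym, symC_toC, add_mul, mul_assoc, mul_assoc,
    Complex.add_im, ← Complex.ofReal_intCast, ← Complex.ofReal_intCast, Complex.im_ofReal_mul,
    Complex.im_ofReal_mul]
  rfl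

theorem offset_re : ∃ e : ℝ, e ^ 2 = 1 ∧ ∀ p, (B.offset p).re =
    ((s - B.b) / h * B.rot).re + e * linForm B.β (-B.α) p := by
  obtain ⟨a, b, hab, hr⟩ := B.exists_rot
  have h1 : ∀ w : ℂ, symC B.k B.f w * B.rot =
      (if B.f then starRingEnd ℂ w else w) * ⟨a, b⟩ := fun w => by rw [← hr, symC]; ring
  refine ⟨if B.f then -1 else 1, by cases B.f <;> simp, fun p => ?_⟩
  rw [offset, add_mul, Complex.add_re, toC_sym, h1, add_comm, linForm, α, β, h1, h1]
  cases B.f <;> simp [toC] <;> ring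

theorem sum_stencil (f : ℤ × ℤ → ℝ) :
    ∑ p ∈ B.stencil, f p = ∑ p ∈ B.case.type.stencil, f (sym B.k B.f p) :=
  Finset.sum_image (sym_injective _ _).injOn

theorem System.zeroth {B : BoundarySetup Ω h s} {D : ℕ → ℕ → ℂ} {c : ℤ × ℤ → ℕ → ℝ}
    (hc : B.System D c) (m : Fin 5) :
    ∑ p ∈ B.case.type.stencil, c (sym B.k B.f p) 0 * oddHarmonic B.α B.β B.δ p m = 0 := by
  obtain ⟨e, he, hre⟩ := B.offset_re
  refine sum_mul_oddHarmonic_eq_zero _ _ _ _ B.offset _ e he hre B.offset_im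
    (fun m hm1 hm5 => ?_) m
  have h1 := hc 0 m (by norm_num) hm1 (by omega)
  rw [Finset.range_zero, Finset.sum_empty, neg_eq_zero, B.sum_stencil] at h1
  have h2 : (-2 / m.factorial : ℝ) ≠ 0 := div_ne_zero (by norm_num) (by positivity)
  refine (mul_eq_zero.1 ?_).resolve_left h2
  rw [Finset.mul_sum, ← h1]
  refine Finset.sum_congr rfl fun p _ => ?_
  rw [coefABoundary_self, offset, rot]
  ring

theorem im_sub_mul_rot (hh : 0 < h) (p : ℤ × ℤ) :
    ((s + h * toC (sym B.k B.f p) - B.b) * B.rot).im = h * (linForm B.α B.β p + B.δ) := by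
  rw [← B.offset_im, offset, ← Complex.im_ofReal_mul]
  congr 1
  have : (h : ℂ) ≠ 0 := by exact_mod_cast hh.ne'
  field_simp
  ring

theorem δ_eq (hh : 0 < h) : ((s - B.b) * B.rot).im = h * B.δ := by
  have := B.im_sub_mul_rot hh (0, 0)
  simpa [sym_zero, toC, linForm] using this

theorem δ_pos (hh : 0 < h) : 0 < B.δ := by
  have h1 := B.left
  change 0 < ((s - B.b) * B.rot).im at h1
  rw [B.δ_eq hh] at h1
  exact pos_of_mul_pos_right h1 hh.le

theorem exists_ray (hh : 0 < h) : ∃ r : ℝ, 0 ≤ r ∧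
    B.δ + r * linForm B.α B.β B.case.type.dir = 0 ∧
    ‖B.C - s‖ / h = r * ‖toC B.case.type.dir‖ := by
  obtain ⟨r, hr, hC⟩ := B.C_ray
  obtain ⟨y, hy⟩ := B.C_mem
  refine ⟨r, hr, ?_, ?_⟩
  · have h1 : ((B.C - B.b) * B.rot).im = 0 := by
      rw [hy, add_sub_cancel_left, mul_assoc, mul_comm (Complex.exp _), B.rot_mul_exp]
      simp
    have h2 : (B.C - B.b) * B.rot = (s - B.b) * B.rot + ((r * h : ℝ) : ℂ) *
        (symC B.k B.f (toC B.case.type.dir) * B.rot) := by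
      rw [hC, toC_sym]; push_cast; ring
    have h3 := B.offset_im B.case.type.dir
    rw [h2, Complex.add_im, B.δ_eq hh, Complex.im_ofReal_mul] at h1
    rw [offset, add_mul, Complex.add_im, toC_sym, ← δ] at h3
    rw [add_right_cancel h3] at h1
    have : h * (B.δ + r * linForm B.α B.β B.case.type.dir) = 0 := by linarith
    exact (mul_eq_zero.1 this).resolve_left hh.ne'
  · rw [hC, add_sub_cancel_left, norm_mul, norm_mul, toC_sym, norm_symC, Complex.norm_real,
      Complex.norm_real, Real.norm_of_nonneg hr, Real.norm_of_nonneg hh.le]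
    field_simp

/-- Without a reflection `(α, β) = (-sin θ₀, cos θ₀)`; with one, both entries change sign and the
quotient stays the same. -/
theorem tan_eq : Real.tan (B.θ₀ - Real.pi / 4) = -(B.α + B.β) / (B.β - B.α) := by
  obtain ⟨a, b, hab, hr⟩ := B.exists_rot
  have h1 : ∀ w : ℂ, symC B.k B.f w * B.rot =
      (if B.f then starRingEnd ℂ w else w) * ⟨a, b⟩ := fun w => by rw [← hr, symC]; ring
  have h2 := congrArg (· * B.rot) B.θ₀_spec
  simp only [mul_comm (Complex.exp (tangentAngle B.γ B.t * Complex.I)), B.rot_mul_exp, h1] at h2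
  rw [Complex.exp_mul_I, ← Complex.ofReal_cos, ← Complex.ofReal_sin] at h2
  have h3 : Real.tan (B.θ₀ - Real.pi / 4) = (Real.sin B.θ₀ - Real.cos B.θ₀) /
      (Real.cos B.θ₀ + Real.sin B.θ₀) := by
    rw [Real.tan_eq_sin_div_cos, Real.sin_sub, Real.cos_sub, Real.cos_pi_div_four,
      Real.sin_pi_div_four, ← sub_mul, ← add_mul, mul_div_mul_right _ _ (by positivity)]
  have hcs := Real.sin_sq_add_cos_sq B.θ₀
  rw [h3, α, β, h1, h1]
  generalize Real.cos B.θ₀ = x at *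
  generalize Real.sin B.θ₀ = y at *
  have h4 := congrArg Complex.re h2
  have h5 := congrArg Complex.im h2
  cases hf : B.f
  · simp [hf] at h4 h5 ⊢
    have ha : a = x := by
      linear_combination -a * hcs + x * h4 + y * h5
    have hb : b = -y := by
      linear_combination -b * hcs - y * h4 + x * h5
    rw [ha, hb]; congr 1 <;> ring
  · simp [hf] at h4 h5 ⊢
    have ha : a = x := by
      linear_combination -a * hcs + x * h4 - y * h5
    have hb : b = y := by
      linear_combination -b * hcs + y * h4 + x * h5
    rw [ha, hb, ← neg_div_neg_eq]; congr 1 <;> ring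

/-- The ray towards `C` gives `δ = r β` or `δ = r (β - α)`, where `r` counts steps in the direction
`dir`. In the third type `|C - s| / h` is `√2` times this `r`, which cancels the `√2` of the extra
equations. -/
theorem merged_eq (hh : 0 < h) {l : Bool} (hg : B.case.type.Good l B.α B.β B.δ)
    (c : ℤ × ℤ → ℝ) (hc : B.case.type.ExtraEqs (‖B.C - s‖ / h) B.θ₀ c) :
    ∀ x ∈ (B.case.type.oddSystem l).merged, c x.1 = c ((B.case.type.oddSystem l).unknown x.2) -
      linForm B.α B.β (B.case.type.oddSystem l).shift * B.δ /
        ((B.case.type.oddSystem l).scale *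
          linForm B.α B.β (B.case.type.oddSystem l).root ^ 2) := by
  obtain ⟨r, hr, h1, h2⟩ := B.exists_ray hh
  have hroot := hg.root
  have hside := hg.side
  have htan := B.tan_eq
  rw [h2] at hc
  clear hg h2
  generalize B.case.type = T at *
  generalize B.α = α at *
  generalize B.β = β at *
  generalize B.δ = δ at *
  generalize B.θ₀ = θ at *
  cases T
  · simp [StencilType.oddSystem, StencilType.ExtraEqs, linForm, StencilType.dir, toC] at *
    have hβ : β ≠ 0 := by linarith
    have : δ = r * β := by linarith
    subst this
    field_simp
    linarith
  · simp [StencilType.oddSystem, StencilType.ExtraEqs, linForm, StencilType.dir, toC] at *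
    have hβ : β ≠ 0 := by linarith
    have : δ = r * β := by linarith
    subst this
    field_simp
    constructor <;> linarith
  · simp only [StencilType.ExtraEqs, htan] at hc
    have hρ : 0 < β - α := by
      simp [StencilType.oddSystem, linForm] at hroot
      linarith
    have h2 : δ = r * (β - α) := by
      simp [StencilType.dir, linForm] at h1
      linarith
    have h3 : ‖toC StencilType.three.dir‖ = √2 := by
      simp [StencilType.dir, toC, Complex.norm_def, Complex.normSq_apply]
      norm_num
    have h4 : (1 + |-(α + β) / (β - α)|) * (r * ‖toC StencilType.three.dir‖) / (15 * √2) =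
        linForm α β (StencilType.three.oddSystem l).shift * δ /
          (15 * linForm α β (StencilType.three.oddSystem l).root ^ 2) := by
      have h5 : linForm α β (StencilType.three.oddSystem l).root = β - α := by
        simp [StencilType.oddSystem, linForm]; ring
      have h6 : linForm α β (StencilType.three.oddSystem l).shift = β - α + |α + β| := by
        rw [hside rfl]
        cases l <;> simp [StencilType.oddSystem, linForm] <;> ring
      rw [abs_div, abs_neg, abs_of_pos hρ, h3, h5, h6, h2]
      field_simp
    rw [neg_div, h4] at hc
    simp only [StencilType.oddSystem, List.mem_cons, List.not_mem_nil, or_false]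
    rintro x (rfl | rfl)
    · exact eq_add_of_sub_eq' hc.1
    · exact eq_add_of_sub_eq' hc.2
  · simp [StencilType.oddSystem, StencilType.ExtraEqs, linForm] at *
    constructor <;> linarith
  · simp [StencilType.oddSystem]
  · simp [StencilType.oddSystem]

theorem zeroth_signs (hh : 0 < h) (hfit : B.case.Fits B.α B.β B.δ) {D : ℕ → ℕ → ℂ}
    {c : ℤ × ℤ → ℕ → ℝ} (hsys : B.System D c) (hc : c (0, 0) 0 = 1)
    (hextra : B.case.type.ExtraEqs (‖B.C - s‖ / h) B.θ₀ (fun p => c (sym B.k B.f p) 0)) :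
    (∀ p ∈ B.stencil, p ≠ (0, 0) → c p 0 < 0) ∧ 0 < ∑ p ∈ B.stencil, c p 0 := by
  obtain ⟨l, hl⟩ := B.case.good B.α_sq_add_β_sq hfit
  have h1 := StencilType.signs hl.admissible (fun p => c (sym B.k B.f p) 0) (B.δ_pos hh)
    (by linarith [hl.root]) (by rw [sym_zero, hc]) hsys.zeroth
    (B.merged_eq hh hl _ hextra)
  refine ⟨fun p hp hp0 => ?_, ?_⟩
  · obtain ⟨q, hq, rfl⟩ := Finset.mem_image.1 hp
    refine h1.1 q hq fun h0 => hp0 ?_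
    rw [h0, sym_zero]
  · rw [B.sum_stencil]
    exact h1.2

end BoundarySetup

/-! ### The boundary near its tangent lines -/

/-- Near `b`, the boundary lies in a double cone with aperture `ε` around each tangent line, and
lines that are transversal to the tangent line meet the boundary in that cone. -/
def NearlyFlat (Ω : Set ℂ) (ε ρ : ℝ) (b : ℂ) : Prop :=
  ∀ (γ : ℝ → ℂ) (t : ℝ), IsLocalParam Ω b γ t →
    (∀ q ∈ frontier Ω, ‖q - b‖ < ρ →
      |((q - b) * Complex.exp (-(tangentAngle γ t * Complex.I))).im| ≤ ε * ‖q - b‖) ∧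
    ∀ s v : ℂ, ‖s - b‖ < ρ → ‖v‖ = 1 →
      1 / 3 ≤ |(v * Complex.exp (-(tangentAngle γ t * Complex.I))).im| →
      ∃ q ∈ frontier Ω,
        |((q - b) * Complex.exp (-(tangentAngle γ t * Complex.I))).im| ≤ ε * ‖q - b‖ ∧
        ∃ r : ℝ, q = s + r * v

/-- `κ` bounds the sine of the angle between the rotations `u` and `ω`; heights measured after the
two rotations differ accordingly. -/
theorem abs_im_mul_le {d u ω : ℂ} {κ : ℝ} (hd : d ≠ 0) (hu : ‖u‖ = 1) (hω : ‖ω‖ = 1)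
    (hdω : d * ω = ‖d‖) (hdu : |(d * u).im| ≤ κ * ‖d‖) (w : ℂ) :
    |(w * ω).im| ≤ |(w * u).im| + κ * ‖w‖ := by
  have hd' : 0 < ‖d‖ := norm_pos_iff.2 hd
  have huu : u * starRingEnd ℂ u = 1 := by
    rw [Complex.mul_conj, Complex.normSq_eq_norm_sq, hu]; norm_num
  have hωω : ω * starRingEnd ℂ ω = 1 := by
    rw [Complex.mul_conj, Complex.normSq_eq_norm_sq, hω]; norm_num
  set g := ω * starRingEnd ℂ u with hg
  have h1 : w * ω = w * u * g := by rw [hg]; linear_combination (-w * ω) * huu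
  have h2 : d * u = ‖d‖ * starRingEnd ℂ g := by
    rw [← hdω, hg, map_mul, Complex.conj_conj]; linear_combination (-d * u) * hωω
  have h3 : |g.im| ≤ κ := by
    rw [h2, Complex.im_ofReal_mul, Complex.conj_im, abs_mul, abs_neg, abs_of_pos hd',
      mul_comm] at hdu
    exact le_of_mul_le_mul_right hdu hd'
  have h4 : ‖g‖ = 1 := by rw [hg, norm_mul, RCLike.norm_conj, hω, hu, one_mul]
  have h5 : |g.re| ≤ 1 := h4 ▸ Complex.abs_re_le_norm g
  have h6 : ‖w * u‖ = ‖w‖ := by rw [norm_mul, hu, mul_one]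
  have h7 := h6 ▸ Complex.abs_re_le_norm (w * u)
  rw [h1, Complex.mul_im]
  calc |(w * u).re * g.im + (w * u).im * g.re|
      ≤ |(w * u).re| * |g.im| + |(w * u).im| * |g.re| := by
        rw [← abs_mul, ← abs_mul]; exact abs_add_le _ _
    _ ≤ ‖w‖ * κ + |(w * u).im| * 1 := by gcongr
    _ = _ := by ring

theorem deriv_mul_exp_neg_tangentAngle (γ : ℝ → ℂ) (t : ℝ) :
    deriv γ t * Complex.exp (-(tangentAngle γ t * Complex.I)) = ‖deriv γ t‖ := by
  have h1 := Complex.norm_mul_exp_arg_mul_I (deriv γ t)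
  have h2 : Complex.exp (tangentAngle γ t * Complex.I) *
      Complex.exp (-(tangentAngle γ t * Complex.I)) = 1 := by
    rw [← Complex.exp_add, add_neg_cancel, Complex.exp_zero]
  rw [tangentAngle] at h2 ⊢
  linear_combination (-Complex.exp (-((deriv γ t).arg * Complex.I))) * h1 + ‖deriv γ t‖ * h2

theorem exists_strict {γ : ℝ → ℂ} {t : ℝ} (hγ : ContDiffAt ℝ 5 γ t) {κ : ℝ} (hκ : 0 < κ) :
    ∀ᶠ δ in 𝓝[>] (0 : ℝ), ∀ x y : ℝ, |x - t| ≤ δ → |y - t| ≤ δ →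
      ‖γ x - γ y - (x - y) * deriv γ t‖ ≤ κ * |x - y| := by
  have h1 : HasStrictDerivAt γ (deriv γ t) t := hγ.hasStrictDerivAt (by norm_num)
  have h2 := (hasStrictFDerivAt_iff_isLittleO.1 h1.hasStrictFDerivAt).def hκ
  rw [Metric.eventually_nhds_iff] at h2
  obtain ⟨δ, hδ, h2⟩ := h2
  filter_upwards [Ioo_mem_nhdsGT hδ] with r hr x y hx hy
  have h3 := @h2 (x, y) (by
    rw [Prod.dist_eq, max_lt_iff, Real.dist_eq, Real.dist_eq]
    exact ⟨hx.trans_lt hr.2, hy.trans_lt hr.2⟩)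
  simpa [Real.norm_eq_abs] using h3

/-- One curve `γ₀` controls all base points near `b₀` and all their parametrizations: by strict
differentiability, all chords of `γ₀` near `t₀` are nearly parallel to `γ₀'(t₀)`. -/
theorem exists_nearlyFlat_ball {Ω : Set ℂ} {b₀ : ℂ} {γ₀ : ℝ → ℂ} {t₀ : ℝ}
    (h₀ : IsLocalParam Ω b₀ γ₀ t₀) {ε : ℝ} (hε : 0 < ε) (hε' : ε ≤ 1 / 10) :
    ∃ ρ > 0, ∀ b ∈ frontier Ω, ‖b - b₀‖ < ρ → NearlyFlat Ω ε ρ b := by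
  obtain ⟨hb₀, hC, hD, hmap⟩ := h₀
  set D := deriv γ₀ t₀ with hDdef
  set μ := ‖D‖ with hμdef
  have hμ : 0 < μ := norm_pos_iff.2 hD
  have hfr : ∀ᶠ x in 𝓝 t₀, γ₀ x ∈ frontier Ω := by
    have : frontier Ω ∈ map γ₀ (𝓝 t₀) := by rw [hmap]; exact self_mem_nhdsWithin
    exact this
  rw [Metric.eventually_nhds_iff] at hfr
  obtain ⟨δ₁, hδ₁, hfr⟩ := hfr
  obtain ⟨δ, hst, hδ, hδ'⟩ := ((exists_strict hC (κ := ε / 4 * μ) (by positivity)).and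
    (Ioo_mem_nhdsGT hδ₁)).exists
  rw [← hDdef] at hst
  have hfr' : ∀ x, |x - t₀| ≤ δ → γ₀ x ∈ frontier Ω := fun x hx =>
    hfr (by rw [Real.dist_eq]; exact hx.trans_lt hδ')
  have him : γ₀ '' Metric.ball t₀ (δ / 2) ∈ 𝓝[frontier Ω] b₀ := by
    rw [← hmap]
    exact image_mem_map (Metric.ball_mem_nhds _ (by positivity))
  rw [Metric.mem_nhdsWithin_iff] at him
  obtain ⟨ρ₁, hρ₁, him⟩ := him
  have hparam : ∀ q ∈ frontier Ω, ‖q - b₀‖ < ρ₁ → ∃ x, |x - t₀| < δ / 2 ∧ γ₀ x = q := by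
    intro q hq hqb
    obtain ⟨x, hx, hxq⟩ := him ⟨by rwa [Metric.mem_ball, dist_eq_norm], hq⟩
    exact ⟨x, by rwa [Metric.mem_ball, Real.dist_eq] at hx, hxq⟩
  set u := starRingEnd ℂ D / μ with hu
  have hu1 : ‖u‖ = 1 := by
    rw [hu, norm_div, RCLike.norm_conj, Complex.norm_real, norm_norm, div_self hμ.ne']
  have hDu : D * u = μ := by
    rw [hu, mul_div_assoc', Complex.mul_conj, Complex.normSq_eq_norm_sq, ← hμdef]
    have : (μ : ℂ) ≠ 0 := by exact_mod_cast hμ.ne'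
    push_cast
    field_simp
  -- differences of points of the curve
  have hcone : ∀ x y, |x - t₀| ≤ δ → |y - t₀| ≤ δ →
      |((γ₀ x - γ₀ y) * u).im| ≤ ε / 2 * ‖γ₀ x - γ₀ y‖ := by
    intro x y hx hy
    have h1 := hst x y hx hy
    set e := γ₀ x - γ₀ y - (x - y) * D with he
    have h2 : (γ₀ x - γ₀ y) * u = ((x - y) * μ : ℝ) + e * u := by
      push_cast
      rw [← hDu, he]; ring
    have h3 : |((γ₀ x - γ₀ y) * u).im| ≤ ‖e‖ := by
      rw [h2, Complex.add_im, Complex.ofReal_im, zero_add]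
      refine (Complex.abs_im_le_norm _).trans ?_
      rw [norm_mul, hu1, mul_one]
    have h4 : |x - y| * μ ≤ ‖γ₀ x - γ₀ y‖ + ‖e‖ := by
      have : ((x : ℂ) - y) * D = γ₀ x - γ₀ y - e := by rw [he]; ring
      calc |x - y| * μ = ‖((x : ℂ) - y) * D‖ := by
            rw [norm_mul, ← Complex.ofReal_sub, Complex.norm_real, Real.norm_eq_abs]
        _ ≤ _ := by rw [this]; exact norm_sub_le _ _
    nlinarith [abs_nonneg (x - y), norm_nonneg e, norm_nonneg (γ₀ x - γ₀ y)]
  -- `ρ₁ / 2` keeps the `ρ`-ball around `b` within the range of `γ₀`; `μ δ / 20` makes `‖s - b‖`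
  -- small against the height `μ δ / 8` that the curve gains transversally to `v`.
  refine ⟨min (ρ₁ / 2) (μ * δ / 20), by positivity, fun b hb hbb₀ γ t hγ => ?_⟩
  have hbρ := lt_min_iff.1 hbb₀
  obtain ⟨t₁, ht₁, rfl⟩ := hparam b hb (by linarith)
  set ω := Complex.exp (-(tangentAngle γ t * Complex.I)) with hω
  have hω1 : ‖ω‖ = 1 := by
    rw [hω, ← neg_mul, ← Complex.ofReal_neg, Complex.norm_exp_ofReal_mul_I]
  have hdω := deriv_mul_exp_neg_tangentAngle γ t
  rw [← hω] at hdω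
  obtain ⟨hγb, hγC, hγd, hγmap⟩ := hγ
  set d := deriv γ t with hd
  -- `γ` and `γ₀` are compared only through the boundary set: difference quotients of `γ` are real
  -- multiples of chords of `γ₀`, and the cone condition is closed.
  have hdu : |(d * u).im| ≤ ε / 2 * ‖d‖ := by
    have h1 : Tendsto (slope γ t) (𝓝[≠] t) (𝓝 d) :=
      hasDerivAt_iff_tendsto_slope.1 (hγC.differentiableAt (by norm_num)).hasDerivAt
    have h2 : IsClosed {w : ℂ | |(w * u).im| ≤ ε / 2 * ‖w‖} :=
      isClosed_le (Complex.continuous_im.comp (continuous_id.mul continuous_const)).abs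
        (continuous_const.mul continuous_norm)
    refine h2.mem_of_tendsto h1 ?_
    have h3 : ∀ᶠ x in 𝓝 t, γ x ∈ frontier Ω ∧ ‖γ x - b₀‖ < ρ₁ := by
      have : {q | q ∈ frontier Ω ∧ ‖q - b₀‖ < ρ₁} ∈ map γ (𝓝 t) := by
        rw [hγmap]
        have hopen : IsOpen {q : ℂ | ‖q - b₀‖ < ρ₁} := isOpen_lt (by fun_prop) continuous_const
        refine inter_mem_nhdsWithin _ (hopen.mem_nhds ?_)
        change ‖γ₀ t₁ - b₀‖ < ρ₁
        linarith
      exact this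
    filter_upwards [nhdsWithin_le_nhds h3] with x hx
    obtain ⟨y, hy, hyx⟩ := hparam _ hx.1 hx.2
    have h4 := hcone y t₁ (by linarith) (by linarith)
    rw [hyx] at h4
    change |(slope γ t x * u).im| ≤ ε / 2 * ‖slope γ t x‖
    rw [slope_def_module, hγb, smul_mul_assoc, Complex.smul_im, norm_smul,
      smul_eq_mul, abs_mul, Real.norm_eq_abs]
    nlinarith [abs_nonneg (x - t)⁻¹]
  have hcone' : ∀ x, |x - t₀| ≤ δ → |((γ₀ x - γ₀ t₁) * ω).im| ≤ ε * ‖γ₀ x - γ₀ t₁‖ := by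
    intro x hx
    have h1 := abs_im_mul_le hγd hu1 hω1 hdω hdu (γ₀ x - γ₀ t₁)
    have h2 := hcone x t₁ hx (by linarith)
    linarith
  refine ⟨fun q hq hqb => ?_, fun s v hs hv hvω => ?_⟩
  · have hqρ := lt_min_iff.1 hqb
    obtain ⟨x, hx, rfl⟩ := hparam q hq (by
      have := norm_sub_le_norm_sub_add_norm_sub q (γ₀ t₁) b₀
      linarith)
    exact hcone' x (by linarith)
  · have hsρ := lt_min_iff.1 hs
    have hvu : 1 / 4 ≤ |(v * u).im| := by
      have h1 := abs_im_mul_le hγd hu1 hω1 hdω hdu v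
      rw [hv] at h1
      linarith
    -- Signed distance from the line `s + ℝ v`. It has opposite signs at `t₁ ± δ / 2`, so a zero is
    -- a boundary point on that line.
    set φ : ℝ → ℝ := fun x => ((γ₀ x - s) * starRingEnd ℂ v).im with hφ
    have hDv : (D * starRingEnd ℂ v).im = -(μ * (v * u).im) := by
      have h1 : D * starRingEnd ℂ v = ((μ : ℝ) : ℂ) * starRingEnd ℂ (v * u) := by
        have huu : u * starRingEnd ℂ u = 1 := by
          rw [Complex.mul_conj, Complex.normSq_eq_norm_sq, hu1]; norm_num
        rw [map_mul, ← hDu]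
        linear_combination (-D * starRingEnd ℂ v) * huu
      rw [h1, Complex.im_ofReal_mul, Complex.conj_im]; ring
    have hφx : ∀ x, |x - t₀| ≤ δ → |φ x + (x - t₁) * (μ * (v * u).im)| ≤
        μ * δ / 20 + ε / 4 * μ * |x - t₁| := by
      intro x hx
      have h1 := hst x t₁ hx (by linarith)
      have h2 : φ x + (x - t₁) * (μ * (v * u).im) =
          ((γ₀ t₁ - s + (γ₀ x - γ₀ t₁ - (x - t₁) * D)) * starRingEnd ℂ v).im := by
        have : (x - t₁) * (μ * (v * u).im) =
            -((((x - t₁ : ℝ) : ℂ)) * (D * starRingEnd ℂ v)).im := by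
          rw [Complex.im_ofReal_mul, hDv]; ring
        rw [this, hφ, ← sub_eq_add_neg, ← Complex.sub_im]
        congr 1
        push_cast
        ring
      rw [h2]
      refine (Complex.abs_im_le_norm _).trans ?_
      rw [norm_mul, RCLike.norm_conj, hv, mul_one]
      refine (norm_add_le _ _).trans (add_le_add ?_ h1)
      rw [norm_sub_rev]
      exact hsρ.2.le
    have hcont : ContinuousOn φ (Set.uIcc (t₁ - δ / 2) (t₁ + δ / 2)) := by
      have h1 : ContinuousOn γ₀ (Set.uIcc (t₁ - δ / 2) (t₁ + δ / 2)) := by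
        refine (LipschitzOnWith.of_dist_le_mul (K := Real.toNNReal ((ε / 4 + 1) * μ))
          fun x hx y hy => ?_).continuousOn
        rw [Set.uIcc_of_le (by linarith), Set.mem_Icc] at hx hy
        rw [abs_lt] at ht₁
        have h2 := hst x y (abs_le.2 ⟨by linarith, by linarith⟩)
          (abs_le.2 ⟨by linarith, by linarith⟩)
        have h3 := norm_le_norm_add_norm_sub' (γ₀ x - γ₀ y) ((x - y) * D)
        rw [norm_mul, ← Complex.ofReal_sub, Complex.norm_real, Real.norm_eq_abs] at h3
        rw [dist_eq_norm, Real.dist_eq, Real.coe_toNNReal _ (by positivity)]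
        push_cast at h2 h3 ⊢
        linarith
      exact Complex.continuous_im.comp_continuousOn
        ((h1.sub continuousOn_const).mul continuousOn_const)
    rw [abs_lt] at ht₁
    have hp := hφx (t₁ + δ / 2) (abs_le.2 ⟨by linarith, by linarith⟩)
    have hm := hφx (t₁ - δ / 2) (abs_le.2 ⟨by linarith, by linarith⟩)
    have hμδ : 0 < μ * δ := mul_pos hμ hδ
    have hsmall : μ * δ / 20 + ε / 4 * μ * (δ / 2) ≤ μ * δ / 10 := by nlinarith
    rw [add_sub_cancel_left, abs_of_pos (half_pos hδ)] at hp
    rw [show t₁ - δ / 2 - t₁ = -(δ / 2) by ring, abs_neg, abs_of_pos (half_pos hδ)] at hm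
    have hzero : (0 : ℝ) ∈ Set.uIcc (φ (t₁ - δ / 2)) (φ (t₁ + δ / 2)) := by
      rw [abs_le] at hp hm
      rw [Set.mem_uIcc]
      rcases le_abs'.1 hvu with h1 | h1
      · left
        have h2 : δ / 2 * (μ * (v * u).im) ≤ -(μ * δ / 8) := by
          linear_combination (μ * δ / 2) * h1
        constructor <;> linarith
      · right
        have h2 : μ * δ / 8 ≤ δ / 2 * (μ * (v * u).im) := by
          linear_combination (μ * δ / 2) * h1
        constructor <;> linarith
    obtain ⟨x, hx, hx0⟩ := intermediate_value_uIcc hcont hzero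
    rw [Set.uIcc_of_le (by linarith), Set.mem_Icc] at hx
    have hx' : |x - t₀| ≤ δ := abs_le.2 ⟨by linarith, by linarith⟩
    refine ⟨γ₀ x, hfr' x hx', hcone' x hx', ((γ₀ x - s) * starRingEnd ℂ v).re, ?_⟩
    have h1 : ((((γ₀ x - s) * starRingEnd ℂ v).re : ℝ) : ℂ) = (γ₀ x - s) * starRingEnd ℂ v :=
      Complex.ext (by simp) (by rw [Complex.ofReal_im]; exact hx0.symm)
    have hvv : v * starRingEnd ℂ v = 1 := by
      rw [Complex.mul_conj, Complex.normSq_eq_norm_sq, hv]; norm_num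
    rw [h1]
    linear_combination (-(γ₀ x - s)) * hvv

theorem exists_nearlyFlat {Ω : Set ℂ} (hbdd : Bornology.IsBounded Ω)
    (hbdry : ∀ b ∈ frontier Ω, ∃ (γ : ℝ → ℂ) (t : ℝ), IsLocalParam Ω b γ t)
    {ε : ℝ} (hε : 0 < ε) (hε' : ε ≤ 1 / 10) :
    ∃ ρ > 0, ∀ b ∈ frontier Ω, NearlyFlat Ω ε ρ b := by
  have hmono : ∀ {ρ ρ' : ℝ} {b : ℂ}, ρ' ≤ ρ → NearlyFlat Ω ε ρ b → NearlyFlat Ω ε ρ' b :=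
    fun hle h γ t hγ => ⟨fun q hq hqb => (h γ t hγ).1 q hq (hqb.trans_le hle),
      fun s v hs => (h γ t hγ).2 s v (hs.trans_le hle)⟩
  have hcomp : IsCompact (frontier Ω) :=
    Metric.isCompact_of_isClosed_isBounded isClosed_frontier
      (hbdd.closure.subset frontier_subset_closure)
  refine hcomp.induction_on (p := fun A => ∃ ρ > 0, ∀ b ∈ A, NearlyFlat Ω ε ρ b)
    ⟨1, one_pos, by simp⟩ (fun A A' hA ⟨ρ, hρ, h⟩ => ⟨ρ, hρ, fun b hb => h b (hA hb)⟩)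
    (fun A A' ⟨ρ, hρ, h⟩ ⟨ρ', hρ', h'⟩ => ⟨min ρ ρ', lt_min hρ hρ', ?_⟩) (fun b₀ hb₀ => ?_)
  · rintro b (hb | hb)
    · exact hmono (min_le_left _ _) (h b hb)
    · exact hmono (min_le_right _ _) (h' b hb)
  · obtain ⟨γ₀, t₀, h₀⟩ := hbdry b₀ hb₀
    obtain ⟨ρ, hρ, h⟩ := exists_nearlyFlat_ball h₀ hε hε'
    refine ⟨Metric.ball b₀ ρ ∩ frontier Ω, ?_, ρ, hρ, fun b hb => ?_⟩
    · rw [Set.inter_comm]; exact inter_mem_nhdsWithin _ (Metric.ball_mem_nhds _ hρ)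
    · exact h b hb.2 (by rw [← dist_eq_norm]; exact hb.1)

/-! ### The stencils stay in the domain -/

theorem norm_le_of_mem_square {s q : ℂ} {h : ℝ} (hq : q ∈ square s h) : ‖q - s‖ ≤ 3 / 2 * h := by
  have h0 : 0 ≤ h := (abs_nonneg _).trans hq.1
  have h1 := sq_le_sq' (by linarith [neg_abs_le (q - s).re, hq.1]) ((le_abs_self _).trans hq.1)
  have h2 := sq_le_sq' (by linarith [neg_abs_le (q - s).im, hq.2]) ((le_abs_self _).trans hq.2)
  have h3 := Complex.sq_norm (q - s)
  rw [Complex.normSq_apply] at h3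
  refine le_of_sq_le_sq ?_ (by positivity)
  nlinarith

theorem isPreconnected_sector (b ω : ℂ) {ε : ℝ} (ρ : ℝ) (hε : 0 ≤ ε) :
    IsPreconnected {q : ℂ | ‖q - b‖ < ρ ∧ ε * ‖q - b‖ < ((q - b) * ω).im} := by
  refine Convex.isPreconnected fun x hx y hy c d hc hd hcd => ?_
  have h1 : c • x + d • y - b = c * (x - b) + d * (y - b) := by
    have h2 : (c : ℂ) + d = 1 := by exact_mod_cast hcd
    rw [Complex.real_smul, Complex.real_smul]
    linear_combination b * h2
  have h2 : ‖c • x + d • y - b‖ ≤ c * ‖x - b‖ + d * ‖y - b‖ := by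
    rw [h1]
    refine (norm_add_le _ _).trans_eq ?_
    rw [norm_mul, norm_mul, Complex.norm_real, Complex.norm_real, Real.norm_of_nonneg hc,
      Real.norm_of_nonneg hd]
  have h3 : ((c • x + d • y - b) * ω).im = c * ((x - b) * ω).im + d * ((y - b) * ω).im := by
    rw [h1, add_mul, mul_assoc, mul_assoc, Complex.add_im, Complex.im_ofReal_mul,
      Complex.im_ofReal_mul]
  have key : ∀ {x₁ x₂ y₁ y₂ : ℝ}, x₁ < x₂ → y₁ < y₂ → c * x₁ + d * y₁ < c * x₂ + d * y₂ := by
    intro x₁ x₂ y₁ y₂ h4 h5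
    rcases hc.eq_or_lt with h0 | h0
    · obtain rfl : d = 1 := by linarith
      rw [← h0]; linarith
    · nlinarith [mul_le_mul_of_nonneg_left h5.le hd, mul_lt_mul_of_pos_left h4 h0]
  refine ⟨h2.trans_lt ?_, ?_⟩
  · have := key hx.1 hy.1
    rwa [← add_mul, hcd, one_mul] at this
  · rw [h3]
    refine lt_of_le_of_lt ?_ (key hx.2 hy.2)
    nlinarith

theorem BdryCase.sq_le_of_mem_stencil (K : BdryCase) {p : ℤ × ℤ} (hp : p ∈ K.type.stencil) :
    p.1 ^ 2 + p.2 ^ 2 ≤ 5 := by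
  cases K <;> revert p <;> decide

theorem BdryCase.notMem_missing (K : BdryCase) {p : ℤ × ℤ} (hp : p ∈ K.type.stencil) :
    p ∉ K.missing := by
  cases K <;> revert p <;> decide

theorem sq_le_of_mem_refStencil {p : ℤ × ℤ} (hp : p ∈ refStencil) : p.1 ^ 2 + p.2 ^ 2 ≤ 5 := by
  revert p; decide

theorem exists_mem_frontier_of_isPreconnected {X : Type*} [TopologicalSpace X] {t Ω : Set X}
    (ht : IsPreconnected t) (h₁ : (t ∩ Ω).Nonempty) (h₂ : (t ∩ Ωᶜ).Nonempty) :
    ∃ x ∈ t, x ∈ frontier Ω := by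
  by_contra! hcon
  have key : ∀ x ∈ t, x ∈ closure Ω → x ∈ interior Ω := fun x hx hc => by
    by_contra hi
    exact hcon x hx ⟨hc, hi⟩
  obtain ⟨y, hy, hyΩ⟩ := h₁
  obtain ⟨z, hz, hzΩ⟩ := h₂
  obtain ⟨x, -, hx₁, hx₂⟩ := ht (interior Ω) (closure Ω)ᶜ isOpen_interior
    isClosed_closure.isOpen_compl
    (fun x hx => or_iff_not_imp_right.2 fun h => key x hx (not_not.1 h))
    ⟨y, hy, key y hy (subset_closure hyΩ)⟩
    ⟨z, hz, fun h => hzΩ (interior_subset (key z hz h))⟩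
  exact hx₂ (subset_closure (interior_subset hx₁))

/-! ### Grid points outside the tangent cone -/

namespace BoundarySetup
variable {Ω : Set ℂ} {h : ℝ} {s : ℂ} (B : BoundarySetup Ω h s)

theorem norm_sub_base_le : ‖s - B.b‖ ≤ 3 / 2 * h := by
  rw [norm_sub_rev]
  exact norm_le_of_mem_square B.isBase.1.2

/-- `s` does not lie in the narrow cone around the tangent line. -/
theorem lt_im_of_nearlyFlat (hh : 0 < h) {ε ρ : ℝ} (hε' : ε ≤ 1 / 100)
    (hρ : 4 * h ≤ ρ) (hflat : NearlyFlat Ω ε ρ B.b) :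
    ε * ‖s - B.b‖ < ((s - B.b) * B.rot).im := by
  by_contra hcon
  push Not at hcon
  have hpos := B.left
  change 0 < ((s - B.b) * B.rot).im at hpos
  have hsb := B.norm_sub_base_le
  -- One of the coordinate axes is transversal to the tangent. If `s` were in the cone, the boundary
  -- would be met along this axis at distance less than `‖s - b‖ / 2`, against the choice of `b` as
  -- a closest ray point.
  obtain ⟨v, hv, hvω, hvaxis⟩ : ∃ v : ℂ, ‖v‖ = 1 ∧ 1 / 3 ≤ |(v * B.rot).im| ∧
      (v.re = 0 ∨ v.im = 0) := by
    by_cases h1 : 1 / 3 ≤ |B.rot.im|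
    · exact ⟨1, by simp, by simpa using h1, by simp⟩
    · refine ⟨Complex.I, by simp, ?_, by simp⟩
      push Not at h1
      have h2 := B.rot_sq
      rw [Complex.I_mul_im]
      by_contra h3
      push Not at h3
      have h4 := sq_lt_sq' (neg_lt_of_abs_lt h1) (lt_of_abs_lt h1)
      have h5 := sq_lt_sq' (neg_lt_of_abs_lt h3) (lt_of_abs_lt h3)
      linarith
  obtain ⟨q, hq, hqcone, r, hr⟩ :=
    (hflat B.γ B.t B.param).2 s v (by linarith) hv hvω
  have hqs : q - s = r * v := by rw [hr]; ring
  have hnorm : ‖q - s‖ = |r| := by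
    rw [hqs, norm_mul, hv, mul_one, Complex.norm_real, Real.norm_eq_abs]
  have hrω : r * (v * B.rot).im = ((q - B.b) * B.rot).im - ((s - B.b) * B.rot).im := by
    rw [← Complex.im_ofReal_mul, ← mul_assoc, ← hqs, ← Complex.sub_im]
    congr 1; ring
  have htri : ‖q - B.b‖ ≤ |r| + ‖s - B.b‖ := hnorm ▸ norm_sub_le_norm_sub_add_norm_sub q s B.b
  have hε0 : 0 < ε * ‖s - B.b‖ := hpos.trans_le hcon
  have hd : 0 < ‖s - B.b‖ := by
    rcases (norm_nonneg (s - B.b)).eq_or_lt with h0 | h0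
    · rw [← h0, mul_zero] at hε0; exact absurd hε0 (lt_irrefl _)
    · exact h0
  have hε : 0 < ε := pos_of_mul_pos_left hε0 hd.le
  have hsmall : |r| < ‖s - B.b‖ / 2 := by
    have h1 : |r| * (1 / 3) ≤ |r * (v * B.rot).im| := by
      rw [abs_mul]; gcongr
    have h2 : |r * (v * B.rot).im| ≤ ε * ‖q - B.b‖ + ε * ‖s - B.b‖ := by
      rw [hrω]
      refine (abs_sub _ _).trans (add_le_add hqcone ?_)
      rw [abs_of_pos hpos]; exact hcon
    nlinarith [abs_nonneg r]
  have hsq : q ∈ square s h := by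
    constructor
    · exact (Complex.abs_re_le_norm _).trans (by rw [hnorm]; linarith)
    · exact (Complex.abs_im_le_norm _).trans (by rw [hnorm]; linarith)
  have hray : q ∈ rayPts Ω h s := by
    refine ⟨⟨hq, hsq⟩, ?_⟩
    rw [hqs, Complex.re_ofReal_mul, Complex.im_ofReal_mul]
    rcases hvaxis with h0 | h0
    · left; rw [h0, mul_zero]
    · right; left; rw [h0, mul_zero]
  have hclose := (B.isBase.2 ⟨q, hray⟩).2 q hray
  rw [hnorm, norm_sub_rev] at hclose
  linarith

/-- The sector above the cone is convex, contains `s ∈ Ω` and has no boundary points; so it does not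
leave `Ω`. -/
theorem mem_of_sector (hh : 0 < h) (hs : s ∈ Ω) {ε ρ : ℝ} (hε : 0 ≤ ε) (hε' : ε ≤ 1 / 100)
    (hρ : 4 * h ≤ ρ) (hflat : NearlyFlat Ω ε ρ B.b) {q : ℂ} (hq : ‖q - B.b‖ < ρ)
    (hq' : ε * ‖q - B.b‖ < ((q - B.b) * B.rot).im) : q ∈ Ω := by
  by_contra hqΩ
  have hsb := B.norm_sub_base_le
  obtain ⟨x, hx, hxf⟩ := exists_mem_frontier_of_isPreconnected
    (isPreconnected_sector B.b B.rot ρ hε)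
    ⟨s, ⟨by linarith, B.lt_im_of_nearlyFlat hh hε' hρ hflat⟩, hs⟩ ⟨q, ⟨hq, hq'⟩, hqΩ⟩
  have h1 := (hflat B.γ B.t B.param).1 x hxf hx.1
  exact absurd (hx.2.trans_le ((le_abs_self _).trans h1)) (lt_irrefl _)

/-- The point is within `3h/2 + 5h/2 = 4h` of the base point, where the cone has height at most `4h
/ 400 = h / 100`. -/
theorem mem_of_linForm (hh : 0 < h) (hs : s ∈ Ω) {ρ : ℝ} (hρ : 4 * h < ρ)
    (hflat : NearlyFlat Ω (1 / 400) ρ B.b) {p : ℤ × ℤ} (hp : ‖toC p‖ ≤ 5 / 2)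
    (hpos : 1 / 100 < linForm B.α B.β p + B.δ) : s + h * toC (sym B.k B.f p) ∈ Ω := by
  have h1 : ‖s + h * toC (sym B.k B.f p) - B.b‖ ≤ 4 * h := by
    have h2 : s + h * toC (sym B.k B.f p) - B.b = (s - B.b) + h * toC (sym B.k B.f p) := by ring
    rw [h2]
    refine (norm_add_le _ _).trans ?_
    rw [norm_mul, toC_sym, norm_symC, Complex.norm_real, Real.norm_of_nonneg hh.le]
    nlinarith [B.norm_sub_base_le]
  refine B.mem_of_sector hh hs (by norm_num) (by norm_num) hρ.le hflat (h1.trans_lt hρ) ?_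
  rw [B.im_sub_mul_rot hh]
  nlinarith

theorem norm_toC_le {p : ℤ × ℤ} (hp : p.1 ^ 2 + p.2 ^ 2 ≤ 5) : ‖toC p‖ ≤ 5 / 2 := by
  refine le_of_sq_le_sq ?_ (by norm_num)
  rw [Complex.sq_norm, Complex.normSq_apply]
  have : ((p.1 : ℝ) ^ 2 + (p.2 : ℝ) ^ 2) ≤ 5 := by exact_mod_cast hp
  simp [toC]
  linarith

/-- A point may be missing because it is outside `Ω` although it lies to the left of the tangent;
then it can be above the tangent by at most `h / 100`. -/
theorem fits (hh : 0 < h) (hs : s ∈ Ω) {ρ : ℝ} (hρ : 4 * h < ρ)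
    (hflat : NearlyFlat Ω (1 / 400) ρ B.b) : B.case.Fits B.α B.β B.δ := by
  intro p hp
  refine ⟨fun hK => ?_, fun hK => ?_⟩
  · have h1 : 0 < ((s + h * toC (sym B.k B.f p) - B.b) * B.rot).im :=
      ((B.pattern p hp).2 hK).2
    rw [B.im_sub_mul_rot hh] at h1
    exact pos_of_mul_pos_right h1 hh.le
  · by_contra hcon
    push Not at hcon
    refine (B.pattern p hp).1
      ⟨B.mem_of_linForm hh hs hρ hflat (norm_toC_le (sq_le_of_mem_refStencil hp))
      hcon, ?_⟩ hK
    · change 0 < ((s + h * toC (sym B.k B.f p) - B.b) * B.rot).im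
      rw [B.im_sub_mul_rot hh]
      nlinarith

theorem mem_of_mem_stencil (hh : 0 < h) (hs : s ∈ Ω) {ρ : ℝ} (hρ : 4 * h < ρ)
    (hflat : NearlyFlat Ω (1 / 400) ρ B.b) {p : ℤ × ℤ} (hp : p ∈ B.stencil) :
    s + h * toC p ∈ Ω := by
  obtain ⟨q, hq, rfl⟩ := Finset.mem_image.1 hp
  obtain ⟨l, hl⟩ := B.case.good B.α_sq_add_β_sq (B.fits hh hs hρ hflat)
  by_cases hqr : q ∈ refStencil
  · exact ((B.pattern q hqr).2 (B.case.notMem_missing hq)).1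
  · exact B.mem_of_linForm hh hs hρ hflat (norm_toC_le (B.case.sq_le_of_mem_stencil hq))
      (by linarith [hl.far q hq hqr])

end BoundarySetup

/-! ### The sign normalization -/

theorem qSeq_succ (lam : ℕ → ℝ) (j : ℕ) :
    qSeq lam (j + 1) = ∑ k ∈ Finset.range (j + 1), lam (k + 1) * qSeq lam (j - k) := by
  rw [qSeq, Finset.sum_range fun k => lam (k + 1) * qSeq lam (j - k)]

theorem qSeq_nonneg {lam : ℕ → ℝ} (hlam : ∀ j, 0 ≤ lam j) (j : ℕ) : 0 ≤ qSeq lam j := by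
  induction j using Nat.strong_induction_on with
  | _ j ih =>
    cases j with
    | zero => simp [qSeq]
    | succ j =>
      rw [qSeq_succ]
      exact Finset.sum_nonneg fun k _ => mul_nonneg (hlam _) (ih _ (by omega))

/-- Substituting the recursion for `q_{j+1}` pairs each `x (k + 1)` with `λ_{k+1} x 0`; the `λ`'s
are chosen so that these brackets have the sign of `x 0`. -/
theorem sum_qSeq_mul_succ (lam x : ℕ → ℝ) (j : ℕ) :
    ∑ k ∈ Finset.range (j + 2), qSeq lam (j + 1 - k) * x k =
      ∑ k ∈ Finset.range (j + 1), qSeq lam (j - k) * (lam (k + 1) * x 0 + x (k + 1)) := by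
  rw [Finset.sum_range_succ', Nat.sub_zero, qSeq_succ, Finset.sum_mul, ← Finset.sum_add_distrib]
  refine Finset.sum_congr rfl fun k _ => ?_
  rw [Nat.add_sub_add_right]
  ring

theorem sum_normalized_neg {lam x : ℕ → ℝ} (hlam : ∀ j, 0 ≤ lam j) (h0 : x 0 < 0)
    (hx : ∀ j, lam j * x 0 + x j ≤ 0) (J : ℕ) {h : ℝ} (hh : 0 ≤ h) :
    ∑ j ∈ Finset.range (J + 1), (∑ k ∈ Finset.range (j + 1), qSeq lam (j - k) * x k) * h ^ j
      < 0 := by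
  rw [Finset.sum_range_succ']
  refine add_neg_of_nonpos_of_neg (Finset.sum_nonpos fun j _ => ?_) (by simpa [qSeq] using h0)
  rw [sum_qSeq_mul_succ]
  exact mul_nonpos_of_nonpos_of_nonneg (Finset.sum_nonpos fun k _ =>
    mul_nonpos_of_nonneg_of_nonpos (qSeq_nonneg hlam _) (hx _)) (pow_nonneg hh _)

theorem lamInterior_nonneg (S : Finset (ℤ × ℤ)) (c : ℤ × ℤ → ℕ → ℝ) (j : ℕ) :
    0 ≤ lamInterior S c j :=
  (Finset.le_fold_max _).2 (Or.inl le_rfl)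

theorem neg_div_le_lamInterior {S : Finset (ℤ × ℤ)} (c : ℤ × ℤ → ℕ → ℝ) (j : ℕ) {p : ℤ × ℤ}
    (hp : p ∈ S) : -(c p j / c p 0) ≤ lamInterior S c j :=
  (Finset.le_fold_max _).2 (Or.inr ⟨p, hp, le_rfl⟩)

theorem lamBoundary_nonneg (S : Finset (ℤ × ℤ)) (c : ℤ × ℤ → ℕ → ℝ) (j : ℕ) :
    0 ≤ lamBoundary S c j :=
  (lamInterior_nonneg S c j).trans (le_max_left _ _)

theorem modified_neg {lam : ℕ → ℝ} {S : Finset (ℤ × ℤ)} {c : ℤ × ℤ → ℕ → ℝ}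
    (hlam : ∀ j, lamInterior S c j ≤ lam j) (J : ℕ) {h : ℝ} (hh : 0 ≤ h) {p : ℤ × ℤ} (hp : p ∈ S)
    (h0 : c p 0 < 0) : modified lam c J h p < 0 := by
  refine sum_normalized_neg (fun j => (lamInterior_nonneg S c j).trans (hlam j)) h0 (fun j => ?_)
    J hh
  have h1 := mul_le_mul_of_nonpos_right ((neg_div_le_lamInterior c j hp).trans (hlam j)) h0.le
  rw [neg_mul, div_mul_cancel₀ _ h0.ne] at h1
  linarith

theorem sum_modified (lam : ℕ → ℝ) (S : Finset (ℤ × ℤ)) (c : ℤ × ℤ → ℕ → ℝ) (J : ℕ) (h : ℝ) :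
    ∑ p ∈ S, modified lam c J h p = ∑ j ∈ Finset.range (J + 1),
      (∑ k ∈ Finset.range (j + 1), qSeq lam (j - k) * ∑ p ∈ S, c p k) * h ^ j := by
  simp only [modified]
  rw [Finset.sum_comm]
  refine Finset.sum_congr rfl fun j _ => ?_
  rw [← Finset.sum_mul, Finset.sum_comm]
  simp only [Finset.mul_sum]

theorem sum_modified_eq_zero (lam : ℕ → ℝ) {S : Finset (ℤ × ℤ)} {c : ℤ × ℤ → ℕ → ℝ} {J : ℕ}
    (hc : ∀ j ≤ J, ∑ p ∈ S, c p j = 0) (h : ℝ) : ∑ p ∈ S, modified lam c J h p = 0 := by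
  rw [sum_modified]
  refine Finset.sum_eq_zero fun j hj => ?_
  rw [Finset.mem_range] at hj
  rw [Finset.sum_eq_zero fun k hk => by
    rw [Finset.mem_range] at hk
    rw [hc k (by omega), mul_zero], zero_mul]

theorem sum_modified_pos {S : Finset (ℤ × ℤ)} {c : ℤ × ℤ → ℕ → ℝ} (J : ℕ) {h : ℝ} (hh : 0 ≤ h)
    (h0 : 0 < ∑ p ∈ S, c p 0) : 0 < ∑ p ∈ S, modified (lamBoundary S c) c J h p := by
  have key := sum_normalized_neg (lamBoundary_nonneg S c) (x := fun j => -∑ p ∈ S, c p j)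
    (neg_neg_of_pos h0) (fun j => ?_) J hh
  · rw [sum_modified]
    simpa only [mul_neg, Finset.sum_neg_distrib, neg_mul, neg_neg_iff_pos] using key
  · have h1 := mul_le_mul_of_nonneg_right
      (le_max_right (lamInterior S c j) (-((∑ p ∈ S, c p j) / ∑ p ∈ S, c p 0))) h0.le
    rw [neg_mul, div_mul_cancel₀ _ h0.ne'] at h1
    change -_ ≤ lamBoundary S c j * _ at h1
    linarith

/-! ### Interior stencils -/

theorem bigATilde_zero (D : ℕ → ℕ → ℂ) (k l : ℕ) :
    bigATilde D 0 0 k l = if k = 0 ∧ l = 0 then 1 else 0 := by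
  induction hn : k + l using Nat.strong_induction_on generalizing k l with
  | _ n ih =>
    rw [bigATilde]
    split_ifs with h1 h2 h2
    · rfl
    · rfl
    · omega
    · refine Finset.sum_eq_zero fun x _ => ?_
      obtain ⟨⟨i, j⟩, hx⟩ := x
      simp only [rect, Finset.mem_erase, Finset.mem_product, Finset.mem_Icc, ne_eq,
        Prod.ext_iff, not_and_or] at hx
      change aTilde D k l i j * bigATilde D 0 0 i j = 0
      rw [ih (i + j) (by omega) i j rfl]
      split_ifs with h3
      -- The factor `m/(2k) + n/(2l) - mn/(kl)` vanishes at `m = n = 0`: constants solve the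
      -- homogeneous equation.
      · simp [aTilde, h3.1, h3.2]
      · rw [mul_zero]

theorem coefA_zero (D : ℕ → ℕ → ℂ) (k : ℕ) (p : ℂ) : coefA D k 0 p = if k = 0 then 1 else 0 := by
  simp only [coefA, bigATilde_zero]
  split_ifs with hk
  · subst hk; simp [taylorN]
  · refine Finset.sum_eq_zero fun j hj => ?_
    rw [if_neg (by omega), mul_zero]

theorem refStencil_eq : refStencil =
    {(-1, -1), (0, -1), (1, -1), (-1, 0), (0, 0), (1, 0), (-1, 1), (0, 1), (1, 1)} := by
  decide

theorem InteriorSystem.sum_eq_zero {D : ℕ → ℕ → ℂ} {c : ℤ × ℤ → ℕ → ℝ} (hc : InteriorSystem D c)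
    {j : ℕ} (hj : j ≤ 7) : ∑ p ∈ refStencil, c p j = 0 := by
  have h1 := hc.1 j 0 hj (Nat.zero_le _)
  simp only [coefA_zero, if_true, Complex.one_re, one_mul] at h1
  rw [h1, neg_eq_zero]
  refine Finset.sum_eq_zero fun k hk => Finset.sum_eq_zero fun p _ => ?_
  rw [Finset.mem_range] at hk
  rw [if_neg (by omega), Complex.zero_re, zero_mul]

theorem InteriorSystem.sum_pow_eq_zero {D : ℕ → ℕ → ℂ} {c : ℤ × ℤ → ℕ → ℝ}
    (hc : InteriorSystem D c) {m : ℕ} (hm : m ≤ 7) :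
    ∑ p ∈ refStencil, toC p ^ m * (c p 0 : ℂ) = 0 := by
  have hfac : ∀ p : ℤ × ℤ, toC p ^ m * (c p 0 : ℂ) =
      (m.factorial : ℂ) * (coefA D m m (toC p) * (c p 0 : ℂ)) := fun p => by
    have h0 : (m.factorial : ℂ) ≠ 0 := Nat.cast_ne_zero.2 m.factorial_ne_zero
    rw [coefA_self]
    field_simp
  simp only [hfac]
  rw [← Finset.mul_sum]
  refine mul_eq_zero_of_right _ (Complex.ext ?_ ?_)
  · rw [Complex.re_sum]
    simpa [Complex.re_mul_ofReal] using hc.1 0 m (Nat.zero_le _) hm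
  · rw [Complex.im_sum]
    rcases Nat.eq_zero_or_pos m with rfl | hm0
    · simp [coefA_zero]
    · simpa [Complex.im_mul_ofReal] using hc.2 0 m (Nat.zero_le _) hm0 hm

/-- The vanishing moments of orders 0 to 5 already force a multiple of the stencil with centre 20,
edges -4 and corners -1. -/
theorem InteriorSystem.neg {D : ℕ → ℕ → ℂ} {c : ℤ × ℤ → ℕ → ℝ}
    (hc : InteriorSystem D c) (h0 : 0 < c (0, 0) 0) {p : ℤ × ℤ} (hp : p ∈ refStencil)
    (hp0 : p ≠ (0, 0)) : c p 0 < 0 := by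
  have key := fun m (hm : m ≤ 7) => hc.sum_pow_eq_zero hm
  have e0 := key 0 (by norm_num)
  have e1 := key 1 (by norm_num)
  have e2 := key 2 (by norm_num)
  have e3 := key 3 (by norm_num)
  have e4 := key 4 (by norm_num)
  have e5 := key 5 (by norm_num)
  clear key
  rw [refStencil_eq] at hp e0 e1 e2 e3 e4 e5
  simp [toC, Complex.ext_iff, pow_succ] at e0 e1 e2 e3 e4 e5
  simp only [Finset.mem_insert, Finset.mem_singleton] at hp
  rcases hp with rfl | rfl | rfl | rfl | rfl | rfl | rfl | rfl | rfl
  all_goals first | exact absurd rfl hp0 | linarith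

/-! ### The discrete maximum principle -/

theorem toC_zero : toC (0, 0) = 0 := by simp [toC]

theorem toC_add (p q : ℤ × ℤ) : toC (p + q) = toC p + toC q := by
  simp only [toC, Prod.fst_add, Prod.snd_add]
  push_cast
  ring

theorem add_mem_gridPts {Ω : Set ℂ} {h : ℝ} {s : ℂ} (hs : s ∈ gridPts Ω h) {p : ℤ × ℤ}
    (hp : s + h * toC p ∈ Ω) : s + h * toC p ∈ gridPts Ω h := by
  obtain ⟨-, q, rfl⟩ := hs
  exact ⟨hp, q + p, by rw [toC_add, mul_add]⟩

theorem finite_gridPts {Ω : Set ℂ} (hbdd : Bornology.IsBounded Ω) {h : ℝ} (hh : 0 < h) :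
    (gridPts Ω h).Finite := by
  obtain ⟨R, hR⟩ := hbdd.exists_norm_le
  obtain ⟨N, hN⟩ := exists_nat_ge (R / h)
  rw [div_le_iff₀ hh] at hN
  have hcoord : ∀ x : ℤ, h * |(x : ℝ)| ≤ R → x ∈ Finset.Icc (-(N : ℤ)) N := fun x hx => by
    rw [Finset.mem_Icc, ← abs_le]
    have h1 : |(x : ℝ)| ≤ N := by
      rw [mul_comm] at hx
      exact le_of_mul_le_mul_right (hx.trans hN) hh
    exact_mod_cast h1
  refine ((Finset.Icc (-(N : ℤ)) N ×ˢ Finset.Icc (-(N : ℤ)) N).finite_toSet.image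
    fun p : ℤ × ℤ => (h : ℂ) * toC p).subset ?_
  rintro s ⟨hs, p, rfl⟩
  have hnorm := hR _ hs
  refine ⟨p, Finset.mem_coe.2 (Finset.mem_product.2 ⟨hcoord _ ?_, hcoord _ ?_⟩), rfl⟩
  · have h1 := (Complex.abs_re_le_norm _).trans hnorm
    rwa [Complex.re_ofReal_mul, abs_mul, abs_of_pos hh, show (toC p).re = p.1 by simp [toC]] at h1
  · have h1 := (Complex.abs_im_le_norm _).trans hnorm
    rwa [Complex.im_ofReal_mul, abs_mul, abs_of_pos hh, show (toC p).im = p.2 by simp [toC]] at h1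

theorem nonempty_gridPts {Ω : Set ℂ} {q : ℂ} {r : ℝ} (hball : Metric.ball q r ⊆ Ω) {h : ℝ}
    (hh : 0 < h) (hr : 2 * h < r) : (gridPts Ω h).Nonempty := by
  have hround : ∀ x : ℝ, |h * ⌊x / h⌋ - x| ≤ h := fun x => by
    have h1 := Int.floor_le (x / h)
    have h2 := Int.lt_floor_add_one (x / h)
    rw [le_div_iff₀ hh] at h1
    rw [div_lt_iff₀ hh] at h2
    rw [abs_le]
    constructor <;> linarith
  refine ⟨h * toC (⌊q.re / h⌋, ⌊q.im / h⌋), hball ?_, _, rfl⟩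
  rw [Metric.mem_ball, dist_eq_norm]
  refine (Complex.norm_le_abs_re_add_abs_im _).trans_lt (lt_of_le_of_lt ?_ hr)
  have h1 := hround q.re
  have h2 := hround q.im
  simp only [toC, Complex.sub_re, Complex.sub_im, Complex.re_ofReal_mul, Complex.im_ofReal_mul]
  simp only [Complex.add_re, Complex.add_im, Complex.mul_re, Complex.mul_im, Complex.intCast_re,
    Complex.intCast_im, Complex.I_re, Complex.I_im, mul_zero, mul_one, sub_zero, add_zero,
    zero_add]
  linarith

/-- A grid function with nonnegative image under a difference operator whose off-diagonal
coefficients are negative attains its minimum at a point where the coefficient sum is positive, if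
at all other points the coefficients sum to zero and the right neighbour is in the stencil. -/
theorem exists_min_of_signs {G E : Set ℂ} (hfin : G.Finite) (hne : G.Nonempty) {h : ℝ}
    (hh : 0 < h) {S : ℂ → Finset (ℤ × ℤ)} {C : ℂ → ℤ × ℤ → ℝ} {V : ℂ → ℝ}
    (hmem : ∀ s ∈ G, ∀ p ∈ S s, s + h * toC p ∈ G)
    (hneg : ∀ s ∈ G, ∀ p ∈ S s, p ≠ (0, 0) → C s p < 0)
    (hpos : ∀ s ∈ G, s ∈ E → 0 < ∑ p ∈ S s, C s p)
    (hzero : ∀ s ∈ G, s ∉ E → (1, 0) ∈ S s ∧ ∑ p ∈ S s, C s p = 0)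
    (hV : ∀ s ∈ G, 0 ≤ ∑ p ∈ S s, C s p * V (s + h * toC p)) :
    ∃ s ∈ G, s ∈ E ∧ (∀ s' ∈ G, V s ≤ V s') ∧ 0 ≤ V s := by
  obtain ⟨m, hmG, hm⟩ := Set.exists_min_image G V hfin hne
  -- The rightmost minimizer: this replaces a propagation of the minimum along paths in the grid.
  obtain ⟨s, ⟨hsG, hsm⟩, hmax⟩ := Set.exists_max_image {s | s ∈ G ∧ V s = V m} Complex.re
    (hfin.subset fun s hs => hs.1) ⟨m, hmG, rfl⟩
  have hmin : ∀ s' ∈ G, V s ≤ V s' := fun s' hs' => hsm ▸ hm s' hs'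
  have hterm : ∀ p ∈ S s, C s p * (V (s + h * toC p) - V s) ≤ 0 := fun p hp => by
    by_cases hp0 : p = (0, 0)
    · rw [hp0, toC_zero, mul_zero, add_zero, sub_self, mul_zero]
    · exact mul_nonpos_of_nonpos_of_nonneg (hneg s hsG p hp hp0).le
        (sub_nonneg.2 (hmin _ (hmem s hsG p hp)))
  have hsplit : ∑ p ∈ S s, C s p * V (s + h * toC p) =
      ∑ p ∈ S s, C s p * (V (s + h * toC p) - V s) + (∑ p ∈ S s, C s p) * V s := by
    rw [Finset.sum_mul, ← Finset.sum_add_distrib]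
    exact Finset.sum_congr rfl fun p _ => by ring
  have hVs := hsplit ▸ hV s hsG
  have hsE : s ∈ E := by
    by_contra hsE
    obtain ⟨h1, hsum⟩ := hzero s hsG hsE
    rw [hsum, zero_mul, add_zero] at hVs
    have h2 := (Finset.sum_eq_zero_iff_of_nonpos hterm).1
      (le_antisymm (Finset.sum_nonpos hterm) hVs) _ h1
    have h3 := (mul_eq_zero.1 h2).resolve_left (hneg s hsG _ h1 (by decide)).ne
    have h4 := hmax _ ⟨hmem s hsG _ h1, (sub_eq_zero.1 h3).trans hsm⟩
    simp [toC] at h4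
    linarith
  refine ⟨s, hsG, hsE, hmin, ?_⟩
  have h1 : 0 ≤ (∑ p ∈ S s, C s p) * V s := by linarith [Finset.sum_nonpos hterm]
  exact nonneg_of_mul_nonneg_right h1 (hpos s hsG hsE)

theorem IsInteriorCoeff.signs {a : ℂ → ℝ} {h : ℝ} (hh : 0 < h) {s : ℂ} {C : ℤ × ℤ → ℝ}
    (hC : IsInteriorCoeff a h s C) :
    (∀ p ∈ refStencil, p ≠ (0, 0) → C p < 0) ∧ ∑ p ∈ refStencil, C p = 0 := by
  obtain ⟨c, hsys, h0, hCc⟩ := hC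
  refine ⟨fun p hp hp0 => ?_, ?_⟩
  · rw [hCc p hp]
    exact modified_neg (fun _ => le_rfl) 7 hh.le hp (hsys.neg h0 hp hp0)
  · rw [Finset.sum_congr rfl hCc]
    exact sum_modified_eq_zero _ (fun j hj => hsys.sum_eq_zero hj) h

theorem BoundarySetup.IsCoeff.signs {Ω : Set ℂ} {h : ℝ} (hh : 0 < h) {s : ℂ}
    {B : BoundarySetup Ω h s} (hfit : B.case.Fits B.α B.β B.δ) {a : ℂ → ℝ} {C : ℤ × ℤ → ℝ}
    (hC : B.IsCoeff a C) :
    (∀ p ∈ B.stencil, p ≠ (0, 0) → C p < 0) ∧ 0 < ∑ p ∈ B.stencil, C p := by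
  obtain ⟨c, hsys, h0, hextra, hCc⟩ := hC
  obtain ⟨hneg, hpos⟩ := B.zeroth_signs hh hfit hsys h0 hextra
  refine ⟨fun p hp hp0 => ?_, ?_⟩
  · rw [hCc p hp]
    exact modified_neg (fun _ => le_max_left _ _) 4 hh.le hp (hneg p hp hp0)
  · rw [Finset.sum_congr rfl hCc]
    exact sum_modified_pos 4 hh.le hpos

theorem add_mem_square {h : ℝ} (hh : 0 < h) (s : ℂ) {p : ℤ × ℤ} (hp : p ∈ refStencil) :
    s + h * toC p ∈ square s h := by
  simp only [refStencil, Finset.mem_product, Finset.mem_Icc, ← abs_le] at hp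
  have hcoord : ∀ x : ℤ, |x| ≤ 1 → |h * (x : ℝ)| ≤ h := fun x hx => by
    rw [abs_mul, abs_of_pos hh]
    exact mul_le_of_le_one_right hh.le (by exact_mod_cast hx)
  constructor
  · simpa [toC] using hcoord _ hp.1
  · simpa [toC] using hcoord _ hp.2

end CompactFDM

open CompactFDM in
theorem mainTheorem5 (Ω : Set ℂ) (hΩ : IsOpen Ω) (hconn : IsConnected Ω)
    (hbdd : Bornology.IsBounded Ω)
    (hbdry : ∀ b ∈ frontier Ω, ∃ (γ : ℝ → ℂ) (t : ℝ), CompactFDM.IsLocalParam Ω b γ t) :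
    ∃ h₀ : ℝ, 0 < h₀ ∧
      ∀ (a : ℂ → ℝ) (U : Set ℂ), IsOpen U → closure Ω ⊆ U → ContDiffOn ℝ 5 a U →
        (∀ z ∈ closure Ω, 0 < a z) →
      ∀ h : ℝ, 0 < h → h < h₀ →
      ∀ (S : ℂ → Finset (ℤ × ℤ)) (C : ℂ → ℤ × ℤ → ℝ), CompactFDM.IsScheme Ω a h S C →
        (∀ s ∈ CompactFDM.gridPts Ω h, ∀ p ∈ S s,
          s + h * CompactFDM.toC p ∈ CompactFDM.gridPts Ω h) ∧
        ∀ v : CompactFDM.gridPts Ω h → ℝ, (∀ s, 0 ≤ CompactFDM.opL Ω h S C v s) →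
          ∃ s₀ : CompactFDM.gridPts Ω h, (s₀ : ℂ) ∈ CompactFDM.boundaryPts Ω h ∧
            (∀ s, v s₀ ≤ v s) ∧ 0 ≤ v s₀ := by
  obtain ⟨ρ, hρ, hflat⟩ := CompactFDM.exists_nearlyFlat hbdd hbdry (ε := 1 / 400) (by norm_num)
    (by norm_num)
  obtain ⟨q, hq⟩ := hconn.nonempty
  obtain ⟨r, hr, hball⟩ := Metric.isOpen_iff.1 hΩ q hq
  -- `4h < ρ` keeps all stencil points in the range of flatness; `2h < r` guarantees a grid point in
  -- the ball around `q`.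
  refine ⟨min (ρ / 4) (r / 2), lt_min (by linarith) (by linarith), ?_⟩
  intro a U _ _ _ _ h hh hh₀ S C hSC
  have hhρ : 4 * h < ρ := by linarith [hh₀.trans_le (min_le_left _ _)]
  have hhr : 2 * h < r := by linarith [hh₀.trans_le (min_le_right _ _)]
  have hint : ∀ s ∈ interiorPts Ω h, (∀ p ∈ S s, s + h * toC p ∈ Ω) ∧ (1, 0) ∈ S s ∧
      (∀ p ∈ S s, p ≠ (0, 0) → C s p < 0) ∧ ∑ p ∈ S s, C s p = 0 := fun s hs => by
    obtain ⟨hS, hC⟩ := hSC.1 s hs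
    rw [hS]
    exact ⟨fun p hp => hs.2 (add_mem_square hh s hp), by decide, hC.signs hh⟩
  have hbd : ∀ s ∈ boundaryPts Ω h, (∀ p ∈ S s, s + h * toC p ∈ Ω) ∧
      (∀ p ∈ S s, p ≠ (0, 0) → C s p < 0) ∧ 0 < ∑ p ∈ S s, C s p := fun s hs => by
    obtain ⟨B, hS, hC⟩ := hSC.2 s hs
    rw [hS]
    have hB := hflat B.b B.isBase.1.1
    exact ⟨fun p hp => B.mem_of_mem_stencil hh hs.1.1 hhρ hB hp,
      hC.signs hh (B.fits hh hs.1.1 hhρ hB)⟩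
  have hmem : ∀ s ∈ gridPts Ω h, ∀ p ∈ S s, s + h * toC p ∈ gridPts Ω h := fun s hs p hp => by
    by_cases hi : s ∈ interiorPts Ω h
    · exact add_mem_gridPts hs ((hint s hi).1 p hp)
    · exact add_mem_gridPts hs ((hbd s ⟨hs, hi⟩).1 p hp)
  refine ⟨hmem, fun v hv => ?_⟩
  classical
  obtain ⟨s, hs, hsE, hmin, hnn⟩ := exists_min_of_signs (finite_gridPts hbdd hh)
    (nonempty_gridPts hball hh hhr) (E := boundaryPts Ω h) hh
    (V := fun z => if hz : z ∈ gridPts Ω h then v ⟨z, hz⟩ else 0) hmem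
    (fun s hs => by
      by_cases hi : s ∈ interiorPts Ω h
      · exact (hint s hi).2.2.1
      · exact (hbd s ⟨hs, hi⟩).2.1)
    (fun s _ hs => (hbd s hs).2.2)
    (fun s hs hsE => by
      have hi : s ∈ interiorPts Ω h := by
        by_contra hi
        exact hsE ⟨hs, hi⟩
      exact ⟨(hint s hi).2.1, (hint s hi).2.2.2⟩)
    (fun s hs => by
      have hL := hv ⟨s, hs⟩
      have hfac : (0 : ℝ) < if s ∈ interiorPts Ω h then (h ^ 2)⁻¹ else 1 := by
        split_ifs <;> positivity
      unfold opL at hL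
      exact nonneg_of_mul_nonneg_right (by convert hL) hfac)
  refine ⟨⟨s, hs⟩, hsE, fun s' => ?_, ?_⟩
  · simpa [hs] using hmin s' s'.2
  · simpa [hs] using hnn
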